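/- Let $k\ge 0$ be an integer and $n=2k+1$. Let $a_1,\dots,a_n$ be a basis of $\mathbb R^n$ and let $A$ be the linear map with $A(a_j)=a_{j+1}$ for $j<n-1$, $A(a_{n-1})=-a_1-\dots-a_{n-1}$ (if $n>1$) and $A(a_n)=a_n$. Fix an $A$-invariant scalar product on $\mathbb R^n$ and an orthonormal basis $e_1,\dots,e_n$ for it such that $e_1,\dots,e_{n-1}\in\mathrm{Span}[a_1,\dots,a_{n-1}]$, $e_n=a_n$, and, for $1\le j\le k$, $$A(e_{2j-1})=\cos\tfrac{2\pi j}{n}\,e_{2j-1}+\sin\tfrac{2\pi j}{n}\,e_{2j},\qquad A(e_{2j})=-\sin\tfrac{2\pi j}{n}\,e_{2j-1}+\cos\tfrac{2\pi j}{n}\,e_{2j}.$$ Let $g(x)=A(x)+\frac1n a_n$, let $\Gamma$ be the group generated by the translations by $a_1,\dots,a_{n-1}$ and by $g$, and let $M^n=\mathbb R^n/\Gamma$ be the corresponding closed flat manifold (the manifolds of this form are the family $\mathcal F_{CHD}$). In the Clifford algebra of $\mathbb R^n$, with $v\cdot v=-\|v\|^2$, put $$\alpha=\prod_{j=1}^k\Bigl(\cos\tfrac{j\pi}{n}+e_{2j-1}e_{2j}\sin\tfrac{j\pi}{n}\Bigr),\qquad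 \alpha_{+}=(-1)^{k(k+1)/2}\alpha,\qquad \alpha_-=-\alpha_+ .$$ These are the two lifts of $A$ to $\mathrm{Spin}(n)$ ($\alpha_+^n=1$, $\alpha_-^n=-1$), and they define two spin structures on $M^n$, through the lifts $\widehat h:\Gamma\to\mathrm{Spin}(n)$ of the holonomy homomorphism with $\widehat h(a_j)=1$ for $j\le n-1$ and $\widehat h(g)=\alpha_\pm$. Let $\Sigma_{2k}=(\mathbb C^2)^{\otimes k}$ be the irreducible complex Clifford module on which, for $j\le n-1$, $e_j$ acts as $I\otimes\dots\otimes I\otimes g_{(j)}\otimes T\otimes\dots\otimes T$ with $[\frac{j-1}{2}]$ factors $T$ and with $g_{(j)}=g_1$ for $j$ odd, $g_{(j)}=g_2$ for $j$ even, and $e_n$ acts as $i\,T\otimes\dots\otimes T$, where $$g_1=\begin{pmatrix} i&0\\0&-i\end{pmatrix},\quad g_2=\begin{pmatrix}0&i\\ i&0\end{pmatrix},\quad T=\begin{pmatrix}0&-i\\ i&0\end{pmatrix}.$$ The Dirac operator of $M^n$ is $D\psi=\sum_j e_j\,\partial\psi/\partial x_j$ on smooth $\psi:\mathbb R^n\to\Sigma_{2k}$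 with $\psi(\gamma x)=\widehat h(\gamma)\psi(x)$ for all $\gamma\in\Gamma$. Its eigenvalues have finite multiplicity, the series $\sum_{\lambda\ne0}\mathrm{sgn}(\lambda)|\lambda|^{-z}$ over its nonzero eigenvalues, repeated according to multiplicity, converges absolutely for $\mathrm{Re}\,z$ large, and its sum extends to a meromorphic function on $\mathbb C$ that is regular at $0$; the value of the extension at $0$ is the eta invariant, denoted $\eta_{M^n,\alpha_\pm}$. Then both eta invariants are defined and $$\eta_{M^n,\alpha_+}-\eta_{M^n,\alpha_-}\in 2\mathbb Z .$$ -/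

import Mathlib

open scoped Matrix ContDiff InnerProductSpace

noncomputable section

namespace FlatCHD

/-! ### The complex spinor module -/

/-- The spinor module `ℂ² ⊗ ⋯ ⊗ ℂ²` (`k` factors), in coordinates with respect to the basis
of tensor products of standard basis vectors of `ℂ²`. -/
abbrev Spinor (k : ℕ) : Type := (Fin k → Fin 2) → ℂ

/-- Complex matrices acting on `Spinor k`. -/
abbrev SpinorMatrix (k : ℕ) : Type := Matrix (Fin k → Fin 2) (Fin k → Fin 2) ℂ

/-- The matrix `g₁`. -/
def g1 : Matrix (Fin 2) (Fin 2) ℂ := !![Complex.I, 0; 0, -Complex.I]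

/-- The matrix `g₂`. -/
def g2 : Matrix (Fin 2) (Fin 2) ℂ := !![0, Complex.I; Complex.I, 0]

/-- The matrix `T`. -/
def gT : Matrix (Fin 2) (Fin 2) ℂ := !![0, -Complex.I; Complex.I, 0]

/-- The tensor product `B 0 ⊗ ⋯ ⊗ B (k - 1)`. -/
def tensorMatrix {k : ℕ} (B : Fin k → Matrix (Fin 2) (Fin 2) ℂ) : SpinorMatrix k :=
  Matrix.of fun s t => ∏ m, B m (s m) (t m)

/-- The `m`-th tensor factor of Clifford multiplication by the basis vector of index `j`
(indices start at `0`): the last `j / 2` factors are `T`, the factor before them is `g₁` or `g₂`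
according to the parity of `j`, and all other factors are the identity. -/
def gammaFactor {k : ℕ} (j : Fin (2 * k + 1)) (m : Fin k) : Matrix (Fin 2) (Fin 2) ℂ :=
  if k ≤ m.val + j.val / 2 then gT
  else if m.val + j.val / 2 + 1 = k then (if j.val % 2 = 0 then g1 else g2)
  else 1

/-- Clifford multiplication by the basis vector of index `j` on `Spinor k`; for the last index it
is `i (T ⊗ ⋯ ⊗ T)`. -/
def gamma {k : ℕ} (j : Fin (2 * k + 1)) : SpinorMatrix k :=
  (if j.val = 2 * k then Complex.I else 1) • tensorMatrix (gammaFactor j)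

theorem tensorMatrix_mul {k : ℕ} (B C : Fin k → Matrix (Fin 2) (Fin 2) ℂ) :
    tensorMatrix B * tensorMatrix C = tensorMatrix fun m => B m * C m := by
  ext s t
  simp only [tensorMatrix, Matrix.mul_apply, Matrix.of_apply]
  rw [Finset.prod_univ_sum]
  simp [Finset.prod_mul_distrib]

theorem tensorMatrix_smul {k : ℕ} (c : Fin k → ℂ) (B : Fin k → Matrix (Fin 2) (Fin 2) ℂ) :
    tensorMatrix (fun m => c m • B m) = (∏ m, c m) • tensorMatrix B := by
  ext s t
  simp [tensorMatrix, Finset.prod_mul_distrib]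

theorem tensorMatrix_one {k : ℕ} :
    tensorMatrix (fun _ : Fin k => (1 : Matrix (Fin 2) (Fin 2) ℂ)) = 1 := by
  ext s t
  by_cases h : s = t
  · subst h; simp [tensorMatrix]
  · obtain ⟨m, hm⟩ := Function.ne_iff.mp h
    simp only [tensorMatrix, Matrix.of_apply, Matrix.one_apply_ne h]
    exact Finset.prod_eq_zero (Finset.mem_univ m) (Matrix.one_apply_ne hm)

theorem g1_sq : g1 * g1 = -1 := by
  ext i j; fin_cases i <;> fin_cases j <;> simp [g1, Matrix.mul_apply]

theorem g2_sq : g2 * g2 = -1 := by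
  ext i j; fin_cases i <;> fin_cases j <;> simp [g2, Matrix.mul_apply]

theorem gT_sq : gT * gT = 1 := by
  ext i j; fin_cases i <;> fin_cases j <;> simp [gT, Matrix.mul_apply]

theorem g1_g2 : g1 * g2 = -(g2 * g1) := by
  ext i j; fin_cases i <;> fin_cases j <;> simp [g1, g2, Matrix.mul_apply]

theorem g1_gT : g1 * gT = -(gT * g1) := by
  ext i j; fin_cases i <;> fin_cases j <;> simp [g1, gT, Matrix.mul_apply]

theorem g2_gT : g2 * gT = -(gT * g2) := by
  ext i j; fin_cases i <;> fin_cases j <;> simp [g2, gT, Matrix.mul_apply]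

theorem gamma_sq {k : ℕ} (j : Fin (2 * k + 1)) : gamma j * gamma j = -1 := by
  have hj := j.isLt
  have hf : ∀ m : Fin k, gammaFactor j m * gammaFactor j m =
      (if m.val + j.val / 2 + 1 = k then (-1 : ℂ) else 1) •
        (1 : Matrix (Fin 2) (Fin 2) ℂ) := by
    intro m
    unfold gammaFactor
    split_ifs <;> first | omega | simp [g1_sq, g2_sq, gT_sq]
  unfold gamma
  rw [smul_mul_smul_comm, tensorMatrix_mul]
  simp only [hf]
  rw [tensorMatrix_smul, tensorMatrix_one]
  by_cases h : j.val = 2 * k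
  · have : ∀ m : Fin k, ¬ (m.val + j.val / 2 + 1 = k) := fun m => by omega
    simp only [this, if_false, Finset.prod_const_one, one_smul]
    simp [h]
  · have : ∏ m : Fin k, (if m.val + j.val / 2 + 1 = k then (-1 : ℂ) else 1) = -1 := by
      rw [Finset.prod_eq_single (⟨k - 1 - j.val / 2, by omega⟩ : Fin k)]
      · rw [if_pos]; simp only; omega
      · intro b _ hb
        rw [if_neg]
        intro hb'
        exact hb (Fin.ext (by simp only; omega))
      · simp
    simp [this, h]

theorem gamma_anticomm_of_lt {k : ℕ} {j l : Fin (2 * k + 1)} (h : j.val < l.val) :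
    gamma j * gamma l = -(gamma l * gamma j) := by
  have hl := l.isLt
  have hf : ∀ m : Fin k, gammaFactor j m * gammaFactor l m =
      (if m.val + j.val / 2 + 1 = k then (-1 : ℂ) else 1) •
        (gammaFactor l m * gammaFactor j m) := by
    intro m
    unfold gammaFactor
    split_ifs <;> first | omega | simp [g1_g2, g1_gT, g2_gT]
  have hp : ∏ m : Fin k, (if m.val + j.val / 2 + 1 = k then (-1 : ℂ) else 1) = -1 := by
    rw [Finset.prod_eq_single (⟨k - 1 - j.val / 2, by omega⟩ : Fin k)]
    · rw [if_pos]; simp only; omega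
    · intro b _ hb
      rw [if_neg]
      intro hb'
      exact hb (Fin.ext (by simp only; omega))
    · simp
  unfold gamma
  rw [smul_mul_smul_comm, smul_mul_smul_comm, tensorMatrix_mul, tensorMatrix_mul]
  simp only [hf]
  rw [tensorMatrix_smul, hp, mul_comm]
  simp

theorem gamma_anticomm {k : ℕ} {j l : Fin (2 * k + 1)} (h : j ≠ l) :
    gamma j * gamma l = -(gamma l * gamma j) := by
  rcases lt_or_gt_of_ne (fun hh => h (Fin.ext hh) : j.val ≠ l.val) with h | h
  · exact gamma_anticomm_of_lt h
  · rw [gamma_anticomm_of_lt h, neg_neg]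

/-! ### The manifolds -/

variable {k : ℕ} {V : Type*} [NormedAddCommGroup V] [InnerProductSpace ℝ V]

/-- The data defining a flat manifold `V / Γ` of dimension `n = 2 k + 1` in the family, where `V`
is a real vector space with basis `a` and an `A`-invariant scalar product, together with an
adapted orthonormal basis `e`. All indices start at `0`. -/
structure CHDManifold (k : ℕ) (V : Type*) [NormedAddCommGroup V] [InnerProductSpace ℝ V] where
  /-- the basis `a₁, …, aₙ` -/
  a : Module.Basis (Fin (2 * k + 1)) ℝ V
  /-- the generator of the holonomy group; it preserves the scalar product -/
  A : V ≃ₗᵢ[ℝ] V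
  A_a_succ : ∀ (j : ℕ) (h : j + 1 < 2 * k), A (a ⟨j, by omega⟩) = a ⟨j + 1, by omega⟩
  A_a_wrap : ∀ _ : 0 < k, A (a ⟨2 * k - 1, by omega⟩) = -∑ i : Fin (2 * k), a i.castSucc
  A_a_last : A (a (Fin.last (2 * k))) = a (Fin.last (2 * k))
  /-- the orthonormal basis `e₁, …, eₙ` -/
  e : OrthonormalBasis (Fin (2 * k + 1)) ℝ V
  e_mem : ∀ i : Fin (2 * k),
    e i.castSucc ∈ Submodule.span ℝ (Set.range fun i : Fin (2 * k) => a i.castSucc)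
  e_last : e (Fin.last (2 * k)) = a (Fin.last (2 * k))
  A_e_even : ∀ j : Fin k, A (e ⟨2 * j.val, by omega⟩) =
    Real.cos (2 * Real.pi * (j.val + 1) / (2 * k + 1)) • e ⟨2 * j.val, by omega⟩ +
      Real.sin (2 * Real.pi * (j.val + 1) / (2 * k + 1)) • e ⟨2 * j.val + 1, by omega⟩
  A_e_odd : ∀ j : Fin k, A (e ⟨2 * j.val + 1, by omega⟩) =
    -Real.sin (2 * Real.pi * (j.val + 1) / (2 * k + 1)) • e ⟨2 * j.val, by omega⟩ +
      Real.cos (2 * Real.pi * (j.val + 1) / (2 * k + 1)) • e ⟨2 * j.val + 1, by omega⟩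

/-- The negative definite form `v ↦ -⟪v, v⟫`; in its Clifford algebra unit vectors square
to `-1`. -/
def cliffForm (V : Type*) [NormedAddCommGroup V] [InnerProductSpace ℝ V] : QuadraticForm ℝ V :=
  -(LinearMap.BilinMap.toQuadraticMap (innerₗ V))

theorem cliffForm_apply (v : V) : cliffForm V v = -⟪v, v⟫_ℝ := rfl

/-- The Clifford algebra. -/
abbrev Cl (V : Type*) [NormedAddCommGroup V] [InnerProductSpace ℝ V] : Type _ :=
  CliffordAlgebra (cliffForm V)

/-- The inclusion of vectors in the Clifford algebra. -/
abbrev vec (v : V) : Cl V := CliffordAlgebra.ι (cliffForm V) v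

/-- The spin group. -/
abbrev Spin (V : Type*) [NormedAddCommGroup V] [InnerProductSpace ℝ V] :
    Submonoid (Cl V) := spinGroup (cliffForm V)

/-- `Covers y B` means that `λ(y) = B`, where `λ(y) v = y v y*` and `*` reverses products. -/
def Covers (y : Spin V) (B : V ≃ₗᵢ[ℝ] V) : Prop :=
  ∀ v : V, (y : Cl V) * vec v * CliffordAlgebra.reverse (y : Cl V) = vec (B v)

namespace CHDManifold

variable (M : CHDManifold k V)

/-- The affine isometry `g x = A x + (1 / n) aₙ`. -/
def g : V ≃ᵃⁱ[ℝ] V :=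
  AffineIsometryEquiv.constVAdd ℝ V ((1 / (2 * k + 1) : ℝ) • M.a (Fin.last (2 * k))) *
    M.A.toAffineIsometryEquiv

/-- The translation by `v`. -/
def translation (v : V) : V ≃ᵃⁱ[ℝ] V := AffineIsometryEquiv.constVAdd ℝ V v

/-- The deck group `Γ`, generated by the translations by `a₁, …, aₙ₋₁` and by `g`. -/
def deck : Subgroup (V ≃ᵃⁱ[ℝ] V) :=
  Subgroup.closure (insert M.g (Set.range fun i : Fin (2 * k) => translation (M.a i.castSucc)))

/-- A spin structure on `V / Γ`: a lift of the holonomy homomorphism `h : Γ → SO(n)`, which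
sends `γ` to its linear part, to a homomorphism `ĥ : Γ → Spin(n)`. -/
structure SpinStructure where
  lift : M.deck →* Spin V
  covers : ∀ γ : M.deck, Covers (lift γ) (γ : V ≃ᵃⁱ[ℝ] V).linearIsometryEquiv

/-! ### The two spin structures -/

/-- `r_j = cos (j π / n) + e_{2j-1} e_{2j} sin (j π / n)` (here `j` is `j.val + 1`). -/
def r (j : Fin k) : Cl V :=
  algebraMap ℝ (Cl V) (Real.cos ((j.val + 1) * (Real.pi / (2 * k + 1)))) +
    Real.sin ((j.val + 1) * (Real.pi / (2 * k + 1))) •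
      (vec (M.e ⟨2 * j.val, by omega⟩) * vec (M.e ⟨2 * j.val + 1, by omega⟩))

/-- `α = r₁ ⋯ r_k`. -/
def alpha : Cl V := (List.ofFn fun j : Fin k => M.r j).prod

theorem vec_sq {w : V} (hw : ⟪w, w⟫_ℝ = 1) : vec w * vec w = (-1 : Cl V) := by
  rw [vec, CliffordAlgebra.ι_sq_scalar, cliffForm_apply, hw, map_neg, map_one]

theorem vec_anticomm {u v : V} (h : ⟪u, v⟫_ℝ = 0) :
    vec u * vec v = (-(vec v * vec u) : Cl V) := by
  have := CliffordAlgebra.ι_mul_ι_add_swap (Q := cliffForm V) u v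
  rw [eq_neg_iff_add_eq_zero, vec, vec, this]
  have h2 : QuadraticMap.polar (cliffForm V) u v = 0 := by
    simp only [QuadraticMap.polar, cliffForm_apply, inner_add_left, inner_add_right, h,
      real_inner_comm u v]
    ring
  rw [h2, map_zero]

theorem vec_mul_vec_mem_spin {u v : V} (hu : ⟪u, u⟫_ℝ = 1) (hv : ⟪v, v⟫_ℝ = 1) :
    vec u * vec v ∈ Spin V := by
  have key : ∀ w : V, ⟪w, w⟫_ℝ = 1 → vec w ∈ pinGroup (cliffForm V) := fun w hw => by
    rw [pinGroup.mem_iff, Unitary.mem_iff]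
    refine ⟨⟨⟨vec w, -vec w, by simp [vec_sq hw], by simp [vec_sq hw]⟩, ?_, rfl⟩, ?_⟩
    · exact Subgroup.subset_closure ⟨w, rfl⟩
    · simp only [vec, CliffordAlgebra.star_ι]
      simp [vec_sq hw]
  exact ⟨mul_mem (key u hu) (key v hv), CliffordAlgebra.ι_mul_ι_mem_evenOdd_zero _ u v⟩

theorem neg_one_mem_spin (M : CHDManifold k V) : (-1 : Cl V) ∈ Spin V := by
  have h : ⟪M.e (Fin.last (2 * k)), M.e (Fin.last (2 * k))⟫_ℝ = 1 := by
    simp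
  have := vec_mul_vec_mem_spin h h
  rwa [vec_sq h] at this

theorem inner_e_self (i : Fin (2 * k + 1)) : ⟪M.e i, M.e i⟫_ℝ = 1 := by
  simp

theorem inner_e_ne {i j : Fin (2 * k + 1)} (h : i ≠ j) : ⟪M.e i, M.e j⟫_ℝ = 0 :=
  M.e.inner_eq_zero h

theorem r_eq (j : Fin k) : M.r j = vec (-M.e ⟨2 * j.val, by omega⟩) *
    vec (Real.cos ((j.val + 1) * (Real.pi / (2 * k + 1))) • M.e ⟨2 * j.val, by omega⟩ -
      Real.sin ((j.val + 1) * (Real.pi / (2 * k + 1))) • M.e ⟨2 * j.val + 1, by omega⟩) := by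
  have h := vec_sq (M.inner_e_self ⟨2 * j.val, by omega⟩)
  simp only [r, vec, map_neg, map_sub, map_smul, mul_sub, neg_mul, mul_smul_comm] at h ⊢
  rw [h, Algebra.algebraMap_eq_smul_one]
  module

theorem r_mem_spin (j : Fin k) : M.r j ∈ Spin V := by
  rw [r_eq]
  refine vec_mul_vec_mem_spin ?_ ?_
  · simp
  · have h1 := M.inner_e_self ⟨2 * j.val, by omega⟩
    have h2 := M.inner_e_self ⟨2 * j.val + 1, by omega⟩
    have h3 : ⟪M.e ⟨2 * j.val, by omega⟩, M.e ⟨2 * j.val + 1, by omega⟩⟫_ℝ = 0 :=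
      M.inner_e_ne (by simp)
    have h4 : ⟪M.e ⟨2 * j.val + 1, by omega⟩, M.e ⟨2 * j.val, by omega⟩⟫_ℝ = 0 :=
      M.inner_e_ne (by simp)
    simp only [inner_sub_left, inner_sub_right, real_inner_smul_left, real_inner_smul_right,
      h1, h2, h3, h4]
    nlinarith [Real.sin_sq_add_cos_sq ((j.val + 1) * (Real.pi / (2 * k + 1)))]

theorem alpha_mem_spin : M.alpha ∈ Spin V := by
  refine Submonoid.list_prod_mem _ fun x hx => ?_
  obtain ⟨j, rfl⟩ := List.mem_ofFn' _ _ |>.mp hx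
  exact M.r_mem_spin j

theorem mul_reverse_of_mem_spin {y : Cl V} (hy : y ∈ Spin V) :
    y * CliffordAlgebra.reverse y = 1 := by
  have h := spinGroup.mul_star_self_of_mem hy
  rwa [CliffordAlgebra.star_def, spinGroup.involute_eq hy] at h

theorem reverse_mul_of_mem_spin {y : Cl V} (hy : y ∈ Spin V) :
    CliffordAlgebra.reverse y * y = 1 := by
  have h := spinGroup.star_mul_self_of_mem hy
  rwa [CliffordAlgebra.star_def, spinGroup.involute_eq hy] at h

theorem r_conj_of_ne (j : Fin k) (i : Fin (2 * k + 1)) (hi : i.val / 2 ≠ j.val) :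
    M.r j * vec (M.e i) * CliffordAlgebra.reverse (M.r j) = vec (M.e i) := by
  have h1 : vec (M.e ⟨2 * j.val, by omega⟩) * vec (M.e i) =
      -(vec (M.e i) * vec (M.e ⟨2 * j.val, by omega⟩)) :=
    vec_anticomm (M.inner_e_ne (by rintro rfl; simp at hi))
  have h2 : vec (M.e ⟨2 * j.val + 1, by omega⟩) * vec (M.e i) =
      -(vec (M.e i) * vec (M.e ⟨2 * j.val + 1, by omega⟩)) :=
    vec_anticomm (M.inner_e_ne (by rintro rfl; apply hi; simp only; omega))
  have hc : M.r j * vec (M.e i) = vec (M.e i) * M.r j := by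
    simp only [r, add_mul, mul_add, smul_mul_assoc, mul_smul_comm]
    rw [Algebra.commutes, mul_assoc, h2, mul_neg, ← mul_assoc, h1]
    simp only [neg_mul, neg_neg, mul_assoc]
  rw [hc, mul_assoc, mul_reverse_of_mem_spin (M.r_mem_spin j), mul_one]

theorem rotation_identity {R : Type*} [Ring R] [Algebra ℝ R] {x y : R} (hx : x * x = -1)
    (hy : y * y = -1) (hxy : y * x = -(x * y)) (c s : ℝ) :
    (algebraMap ℝ R c + s • (x * y)) * x * (algebraMap ℝ R c + s • (y * x)) =
        (c ^ 2 - s ^ 2) • x + (2 * s * c) • y ∧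
      (algebraMap ℝ R c + s • (x * y)) * y * (algebraMap ℝ R c + s • (y * x)) =
        (-(2 * s * c)) • x + (c ^ 2 - s ^ 2) • y := by
  have hx' : ∀ z, x * (x * z) = -z := fun z => by rw [← mul_assoc, hx, neg_one_mul]
  have hxy' : ∀ z, y * (x * z) = -(x * (y * z)) := fun z => by
    rw [← mul_assoc, hxy, neg_mul, mul_assoc]
  rw [Algebra.algebraMap_eq_smul_one]
  constructor <;>
  · simp only [add_mul, mul_add, smul_mul_assoc, mul_smul_comm, one_mul, mul_one, mul_assoc,
      hy, hxy, hx', hxy', mul_neg, neg_mul, smul_neg, neg_neg]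
    module

theorem reverse_r (j : Fin k) : CliffordAlgebra.reverse (M.r j) =
    algebraMap ℝ (Cl V) (Real.cos ((j.val + 1) * (Real.pi / (2 * k + 1)))) +
    Real.sin ((j.val + 1) * (Real.pi / (2 * k + 1))) •
      (vec (M.e ⟨2 * j.val + 1, by omega⟩) * vec (M.e ⟨2 * j.val, by omega⟩)) := by
  simp [r, vec]

theorem r_conj (j : Fin k) (i : Fin (2 * k + 1)) (hi : i.val / 2 = j.val) :
    M.r j * vec (M.e i) * CliffordAlgebra.reverse (M.r j) = vec (M.A (M.e i)) := by
  have hs : (2 * Real.pi * (j.val + 1) / (2 * k + 1) : ℝ) =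
      2 * ((j.val + 1) * (Real.pi / (2 * k + 1))) := by ring
  have key := rotation_identity (vec_sq (M.inner_e_self ⟨2 * j.val, by omega⟩))
    (vec_sq (M.inner_e_self ⟨2 * j.val + 1, by omega⟩))
    (vec_anticomm (M.inner_e_ne (i := ⟨2 * j.val + 1, by omega⟩) (j := ⟨2 * j.val, by omega⟩)
      (by simp))) (Real.cos ((j.val + 1) * (Real.pi / (2 * k + 1))))
    (Real.sin ((j.val + 1) * (Real.pi / (2 * k + 1))))
  rw [← Real.cos_two_mul', ← Real.sin_two_mul, ← hs] at key
  rw [reverse_r, r]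
  have hcase : i = ⟨2 * j.val, by omega⟩ ∨ i = ⟨2 * j.val + 1, by omega⟩ := by
    simp only [Fin.ext_iff]; omega
  rcases hcase with hh | hh <;> rw [hh]
  · rw [key.1, M.A_e_even]
    simp [vec]
  · rw [key.2, M.A_e_odd]
    simp [vec]

theorem covers_of_basis (y : Spin V) (B : V ≃ₗᵢ[ℝ] V)
    (h : ∀ i, (y : Cl V) * vec (M.e i) * CliffordAlgebra.reverse (y : Cl V) = vec (B (M.e i))) :
    Covers y B := by
  have := M.e.toBasis.ext (f₁ := (LinearMap.mulRight ℝ (CliffordAlgebra.reverse (y : Cl V))) ∘ₗ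
    (LinearMap.mulLeft ℝ (y : Cl V)) ∘ₗ CliffordAlgebra.ι (cliffForm V))
    (f₂ := CliffordAlgebra.ι (cliffForm V) ∘ₗ (B.toLinearEquiv : V →ₗ[ℝ] V))
    (fun i => by simpa using h i)
  intro v
  simpa using LinearMap.congr_fun this v

theorem prefix_conj (m : ℕ) (hm : m ≤ k) (i : Fin (2 * k + 1)) :
    (List.ofFn fun j : Fin m => M.r (j.castLE hm)).prod * vec (M.e i) *
      CliffordAlgebra.reverse (List.ofFn fun j : Fin m => M.r (j.castLE hm)).prod =
      if i.val / 2 < m then vec (M.A (M.e i)) else vec (M.e i) := by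
  induction m generalizing i with
  | zero => simp
  | succ m ih =>
    have hprod : (List.ofFn fun j : Fin (m + 1) => M.r (j.castLE hm)).prod =
        (List.ofFn fun j : Fin m => M.r (j.castLE (by omega))).prod * M.r ⟨m, hm⟩ := by
      rw [List.ofFn_succ', List.concat_eq_append, List.prod_append, List.prod_singleton]
      rfl
    have ih' := ih (by omega)
    rw [hprod, CliffordAlgebra.reverse.map_mul]
    generalize (List.ofFn fun j : Fin m => M.r (j.castLE (by omega : m ≤ k))).prod = P at ih'
    have assoc : P * M.r ⟨m, hm⟩ * vec (M.e i) *
        (CliffordAlgebra.reverse (M.r ⟨m, hm⟩) * CliffordAlgebra.reverse P) =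
        P * (M.r ⟨m, hm⟩ * vec (M.e i) * CliffordAlgebra.reverse (M.r ⟨m, hm⟩)) *
          CliffordAlgebra.reverse P := by simp only [mul_assoc]
    rw [assoc]
    by_cases h : i.val / 2 = m
    · rw [M.r_conj ⟨m, hm⟩ i h, if_pos (by omega)]
      have h0 := ih' ⟨2 * m, by omega⟩
      have h1 := ih' ⟨2 * m + 1, by omega⟩
      rw [if_neg (by simp)] at h0
      rw [if_neg (by simp only; omega)] at h1
      have hcase : i = ⟨2 * m, by omega⟩ ∨ i = ⟨2 * m + 1, by omega⟩ := by
        simp only [Fin.ext_iff]; omega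
      have hA : ∃ c s : ℝ, M.A (M.e i) =
          c • M.e ⟨2 * m, by omega⟩ + s • M.e ⟨2 * m + 1, by omega⟩ := by
        rcases hcase with hh | hh
        · exact ⟨_, _, (congrArg (fun t => M.A (M.e t)) hh).trans (M.A_e_even ⟨m, hm⟩)⟩
        · exact ⟨_, _, (congrArg (fun t => M.A (M.e t)) hh).trans (M.A_e_odd ⟨m, hm⟩)⟩
      obtain ⟨c, s, hcs⟩ := hA
      rw [hcs]
      simp only [vec, map_add, map_smul, mul_add, add_mul, mul_smul_comm, smul_mul_assoc] at h0 h1 ⊢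
      rw [h0, h1]
    · rw [M.r_conj_of_ne ⟨m, hm⟩ i h, ih']
      simp only [show i.val / 2 < m + 1 ↔ i.val / 2 < m by omega]

theorem covers_alpha : Covers ⟨M.alpha, M.alpha_mem_spin⟩ M.A := by
  refine M.covers_of_basis _ _ fun i => ?_
  have h := M.prefix_conj k le_rfl i
  simp only [Fin.castLE_rfl, id] at h
  change M.alpha * vec (M.e i) * CliffordAlgebra.reverse M.alpha = _ at h
  change M.alpha * vec (M.e i) * CliffordAlgebra.reverse M.alpha = _
  rw [h]
  split_ifs with hi
  · rfl
  · have : i = Fin.last (2 * k) := Fin.ext (by simp only [Fin.val_last]; omega)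
    rw [this, M.e_last, M.A_a_last]

/-- `α₊ = (-1) ^ (k (k + 1) / 2) α`, a lift of `A` to the spin group. -/
def alphaPlus : Spin V :=
  ⟨(-1) ^ (k * (k + 1) / 2) * M.alpha,
    mul_mem (pow_mem M.neg_one_mem_spin _) M.alpha_mem_spin⟩

/-- `α₋ = -α₊`, the other lift of `A` to the spin group. -/
def alphaMinus : Spin V := ⟨-1, M.neg_one_mem_spin⟩ * M.alphaPlus

end CHDManifold

theorem covers_neg {x y : Spin V} {B : V ≃ₗᵢ[ℝ] V} (hx : Covers x B) (h : (y : Cl V) = -x) :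
    Covers y B := by
  intro v
  rw [h, map_neg]
  simpa using hx v

theorem covers_one : Covers (1 : Spin V) 1 := by
  intro v; simp

theorem covers_mul {x y : Spin V} {B C : V ≃ₗᵢ[ℝ] V} (hx : Covers x B) (hy : Covers y C) :
    Covers (x * y) (B * C) := by
  intro v
  have h1 := hy v
  have h2 := hx (C v)
  rw [← h1] at h2
  simpa [mul_assoc] using h2

theorem covers_inv {x : Spin V} {B : V ≃ₗᵢ[ℝ] V} (hx : Covers x B) : Covers x⁻¹ B⁻¹ := by
  intro v
  have h := hx (B⁻¹ v)
  have hB : B (B⁻¹ v) = v := B.apply_symm_apply v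
  have hinv : ((x⁻¹ : Spin V) : Cl V) = CliffordAlgebra.reverse (x : Cl V) := by
    change star (x : Cl V) = _
    rw [CliffordAlgebra.star_def, spinGroup.involute_eq x.2]
  have hr := CHDManifold.reverse_mul_of_mem_spin x.2
  rw [hB] at h
  rw [← h, hinv, CliffordAlgebra.reverse_reverse]
  simp only [mul_assoc, hr, mul_one]
  rw [← mul_assoc, hr, one_mul]

theorem covers_zpow {x : Spin V} {B : V ≃ₗᵢ[ℝ] V} (hx : Covers x B) (m : ℤ) :
    Covers (x ^ m) (B ^ m) := by
  induction m using Int.induction_on with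
  | zero => simpa using covers_one
  | succ m ih => rw [zpow_add_one, zpow_add_one]; exact covers_mul ih hx
  | pred m ih => rw [zpow_sub_one, zpow_sub_one]; exact covers_mul ih (covers_inv hx)

namespace CHDManifold

variable (M : CHDManifold k V)

theorem covers_alphaPlus : Covers M.alphaPlus M.A := by
  rcases neg_one_pow_eq_or (Cl V) (k * (k + 1) / 2) with h | h
  · have : M.alphaPlus = ⟨M.alpha, M.alpha_mem_spin⟩ := Subtype.ext (by simp [alphaPlus, h])
    rw [this]; exact M.covers_alpha
  · exact covers_neg M.covers_alpha (by simp [alphaPlus, h])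

theorem covers_alphaMinus : Covers M.alphaMinus M.A :=
  covers_neg M.covers_alphaPlus (by simp [alphaMinus])

theorem inner_e_last_a (j : ℕ) (hj : j < 2 * k) :
    ⟪M.e (Fin.last (2 * k)), M.a ⟨j, by omega⟩⟫_ℝ = 0 := by
  have hA : ∀ v, ⟪M.e (Fin.last (2 * k)), M.A v⟫_ℝ = ⟪M.e (Fin.last (2 * k)), v⟫_ℝ := by
    intro v
    have h : M.A (M.e (Fin.last (2 * k))) = M.e (Fin.last (2 * k)) := by
      rw [M.e_last, M.A_a_last]
    conv_lhs => rw [← h]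
    exact M.A.inner_map_map _ _
  have hc : ∃ C : ℝ, ∀ (i : ℕ) (hi : i < 2 * k),
      ⟪M.e (Fin.last (2 * k)), M.a ⟨i, by omega⟩⟫_ℝ = C := by
    refine ⟨⟪M.e (Fin.last (2 * k)), M.a ⟨0, by omega⟩⟫_ℝ, fun i => ?_⟩
    induction i with
    | zero => intro _; rfl
    | succ i ih =>
      intro hi
      rw [← M.A_a_succ i hi, hA]
      exact ih (by omega)
  obtain ⟨C, hC⟩ := hc
  have hw := congrArg (fun v => ⟪M.e (Fin.last (2 * k)), v⟫_ℝ) (M.A_a_wrap (by omega))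
  rw [hA, inner_neg_right, inner_sum] at hw
  have hs : ∑ i : Fin (2 * k), ⟪M.e (Fin.last (2 * k)), M.a i.castSucc⟫_ℝ =
      ((2 * k : ℕ) : ℝ) * C := by
    rw [Finset.sum_congr rfl (fun i _ => hC i.val i.isLt), Finset.sum_const]
    simp
  rw [hs, hC _ (by omega)] at hw
  rw [hC j hj]
  have h3 : (1 + ((2 * k : ℕ) : ℝ)) * C = 0 := by linarith
  exact (mul_eq_zero.mp h3).resolve_left (by positivity)

theorem linear_mul (f f' : V ≃ᵃⁱ[ℝ] V) :
    (f * f').linearIsometryEquiv = f.linearIsometryEquiv * f'.linearIsometryEquiv := rfl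

theorem linear_inv (f : V ≃ᵃⁱ[ℝ] V) :
    (f⁻¹).linearIsometryEquiv = (f.linearIsometryEquiv)⁻¹ := rfl

theorem linear_g : M.g.linearIsometryEquiv = M.A := by
  ext v
  have h := (M.g).map_vsub v 0
  simp [g] at h
  simpa [g] using h

theorem linear_translation (v : V) : (translation v).linearIsometryEquiv = 1 := by
  ext w
  have h := (translation v).map_vsub w 0
  simpa [translation] using h

theorem inner_e_last_A (v : V) :
    ⟪M.e (Fin.last (2 * k)), M.A v⟫_ℝ = ⟪M.e (Fin.last (2 * k)), v⟫_ℝ := by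
  have h : M.A (M.e (Fin.last (2 * k))) = M.e (Fin.last (2 * k)) := by
    rw [M.e_last, M.A_a_last]
  conv_lhs => rw [← h]
  exact M.A.inner_map_map _ _

/-- `IsWinding γ m` says that `γ` equals `g ^ m` up to a translation orthogonal to `eₙ`. -/
def IsWinding (γ : V ≃ᵃⁱ[ℝ] V) (m : ℤ) : Prop :=
  γ.linearIsometryEquiv = M.A ^ m ∧ ∀ x : V, (2 * k + 1 : ℝ) * ⟪M.e (Fin.last (2 * k)), γ x⟫_ℝ =
    (2 * k + 1 : ℝ) * ⟪M.e (Fin.last (2 * k)), x⟫_ℝ + m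

theorem isWinding_one : M.IsWinding 1 0 := by
  refine ⟨?_, fun x => by simp⟩
  rw [zpow_zero]; rfl

theorem isWinding_mul {γ γ' : V ≃ᵃⁱ[ℝ] V} {m m' : ℤ} (h : M.IsWinding γ m)
    (h' : M.IsWinding γ' m') : M.IsWinding (γ * γ') (m + m') := by
  refine ⟨by rw [linear_mul, h.1, h'.1, zpow_add], fun x => ?_⟩
  have h1 := h.2 (γ' x)
  have h2 := h'.2 x
  rw [AffineIsometryEquiv.coe_mul, Function.comp_apply, h1, h2]
  push_cast; ring

theorem isWinding_inv {γ : V ≃ᵃⁱ[ℝ] V} {m : ℤ} (h : M.IsWinding γ m) :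
    M.IsWinding γ⁻¹ (-m) := by
  refine ⟨by rw [linear_inv, h.1, zpow_neg], fun x => ?_⟩
  have h1 := h.2 (γ⁻¹ x)
  have h2 : γ (γ⁻¹ x) = x := γ.apply_symm_apply x
  rw [h2] at h1
  push_cast; linarith

theorem isWinding_g : M.IsWinding M.g 1 := by
  refine ⟨by rw [linear_g, zpow_one], fun x => ?_⟩
  have h1 : ⟪M.e (Fin.last (2 * k)), M.a (Fin.last (2 * k))⟫_ℝ = 1 := by
    rw [← M.e_last]; simp
  have h2 : (2 * k + 1 : ℝ) ≠ 0 := by positivity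
  simp only [g, AffineIsometryEquiv.coe_mul, Function.comp_apply,
    AffineIsometryEquiv.coe_constVAdd, vadd_eq_add, inner_add_right, inner_smul_right, h1,
    LinearIsometryEquiv.coe_toAffineIsometryEquiv, inner_e_last_A]
  field_simp
  push_cast; ring

theorem isWinding_translation (i : Fin (2 * k)) :
    M.IsWinding (translation (M.a i.castSucc)) 0 := by
  refine ⟨by rw [linear_translation, zpow_zero], fun x => ?_⟩
  have h1 : ⟪M.e (Fin.last (2 * k)), M.a i.castSucc⟫_ℝ = 0 := M.inner_e_last_a i.val i.isLt
  simp [translation, inner_add_right, h1]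

theorem exists_isWinding {γ : V ≃ᵃⁱ[ℝ] V} (hγ : γ ∈ M.deck) : ∃ m, M.IsWinding γ m := by
  induction hγ using Subgroup.closure_induction with
  | mem x hx =>
    rcases hx with rfl | ⟨i, rfl⟩
    · exact ⟨1, M.isWinding_g⟩
    · exact ⟨0, M.isWinding_translation i⟩
  | one => exact ⟨0, M.isWinding_one⟩
  | mul x y _ _ hx hy =>
    obtain ⟨m, hm⟩ := hx
    obtain ⟨m', hm'⟩ := hy
    exact ⟨m + m', M.isWinding_mul hm hm'⟩
  | inv x _ hx =>
    obtain ⟨m, hm⟩ := hx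
    exact ⟨-m, M.isWinding_inv hm⟩

/-- The exponent `m` with `γ = g ^ m` up to a translation orthogonal to `eₙ`. -/
def winding (γ : V ≃ᵃⁱ[ℝ] V) : ℤ :=
  round ((2 * k + 1 : ℝ) * ⟪M.e (Fin.last (2 * k)), γ 0⟫_ℝ)

theorem winding_eq {γ : V ≃ᵃⁱ[ℝ] V} {m : ℤ} (h : M.IsWinding γ m) : M.winding γ = m := by
  rw [winding, h.2 0]; simp

/-- Any lift `y` of `A` to the spin group defines a spin structure, with `ĥ(g) = y` and
`ĥ(aⱼ) = 1` for `j ≤ n - 1`. -/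
def spinStructureOfLift (y : Spin V) (hy : Covers y M.A) : M.SpinStructure where
  lift :=
    { toFun := fun γ => y ^ M.winding γ
      map_one' := by
        change y ^ M.winding (1 : V ≃ᵃⁱ[ℝ] V) = 1
        rw [M.winding_eq M.isWinding_one, zpow_zero]
      map_mul' := fun γ γ' => by
        obtain ⟨m, hm⟩ := M.exists_isWinding γ.2
        obtain ⟨m', hm'⟩ := M.exists_isWinding γ'.2
        change y ^ M.winding ((γ : V ≃ᵃⁱ[ℝ] V) * γ') = _
        rw [M.winding_eq hm, M.winding_eq hm', M.winding_eq (M.isWinding_mul hm hm'), zpow_add] }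
  covers := fun γ => by
    obtain ⟨m, hm⟩ := M.exists_isWinding γ.2
    change Covers (y ^ M.winding γ) _
    rw [M.winding_eq hm, hm.1]
    exact covers_zpow hy m

theorem spinStructureOfLift_g (y : Spin V) (hy : Covers y M.A) (hg : M.g ∈ M.deck) :
    (M.spinStructureOfLift y hy).lift ⟨M.g, hg⟩ = y := by
  change y ^ M.winding M.g = y
  rw [M.winding_eq M.isWinding_g, zpow_one]

theorem spinStructureOfLift_translation (y : Spin V) (hy : Covers y M.A) (i : Fin (2 * k))
    (hi : translation (M.a i.castSucc) ∈ M.deck) :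
    (M.spinStructureOfLift y hy).lift ⟨translation (M.a i.castSucc), hi⟩ = 1 := by
  change y ^ M.winding (translation (M.a i.castSucc)) = 1
  rw [M.winding_eq (M.isWinding_translation i), zpow_zero]

/-- The spin structure given by `α₊`. -/
def spinPlus : M.SpinStructure := M.spinStructureOfLift M.alphaPlus M.covers_alphaPlus

/-- The spin structure given by `α₋`. -/
def spinMinus : M.SpinStructure := M.spinStructureOfLift M.alphaMinus M.covers_alphaMinus

/-! ### Spinors, the Dirac operator and the eta invariant -/

/-- Clifford multiplication by vectors on the spinor module. -/
def cliffordMul : V →ₗ[ℝ] SpinorMatrix k :=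
  ∑ j, (M.e.toBasis.coord j).smulRight (gamma j)

theorem cliffordMul_apply (v : V) : M.cliffordMul v = ∑ j, ⟪M.e j, v⟫_ℝ • gamma j := by
  simp [cliffordMul, OrthonormalBasis.repr_apply_apply]

theorem cliffordMul_e (i : Fin (2 * k + 1)) : M.cliffordMul (M.e i) = gamma i := by
  rw [cliffordMul_apply, Finset.sum_eq_single i]
  · simp
  · intro j _ hj; rw [M.inner_e_ne hj, zero_smul]
  · simp

theorem cliffordMul_sq (v : V) :
    M.cliffordMul v * M.cliffordMul v = algebraMap ℝ (SpinorMatrix k) (cliffForm V v) := by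
  have hadd : M.cliffordMul v * M.cliffordMul v + M.cliffordMul v * M.cliffordMul v =
      (-(2 * ⟪v, v⟫_ℝ)) • (1 : SpinorMatrix k) := by
    have hs : ∀ j l : Fin (2 * k + 1), gamma j * gamma l + gamma l * gamma j =
        (if j = l then (-2 : ℝ) else 0) • (1 : SpinorMatrix k) := by
      intro j l
      split_ifs with h
      · subst h; rw [gamma_sq]; module
      · rw [gamma_anticomm h]; simp
    have hv : ⟪v, v⟫_ℝ = ∑ j, ⟪M.e j, v⟫_ℝ * ⟪M.e j, v⟫_ℝ := by
      rw [← M.e.sum_inner_mul_inner v v]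
      exact Finset.sum_congr rfl fun j _ => by rw [real_inner_comm]
    have h1 : M.cliffordMul v * M.cliffordMul v =
        ∑ j, ∑ l, (⟪M.e j, v⟫_ℝ * ⟪M.e l, v⟫_ℝ) • (gamma j * gamma l) := by
      rw [cliffordMul_apply, Finset.sum_mul_sum]
      simp only [smul_mul_smul_comm]
    have h2 : M.cliffordMul v * M.cliffordMul v =
        ∑ j, ∑ l, (⟪M.e j, v⟫_ℝ * ⟪M.e l, v⟫_ℝ) • (gamma l * gamma j) := by
      rw [h1, Finset.sum_comm]
      exact Finset.sum_congr rfl fun j _ => Finset.sum_congr rfl fun l _ => by rw [mul_comm]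
    calc _ = ∑ j, ∑ l, (⟪M.e j, v⟫_ℝ * ⟪M.e l, v⟫_ℝ) •
          (gamma j * gamma l + gamma l * gamma j) := by
            conv_lhs => rw [h2]
            conv_lhs => arg 1; rw [← h2, h1]
            simp only [smul_add, Finset.sum_add_distrib]
      _ = ∑ j, (⟪M.e j, v⟫_ℝ * ⟪M.e j, v⟫_ℝ) • ((-2 : ℝ) • (1 : SpinorMatrix k)) := by
            refine Finset.sum_congr rfl fun j _ => ?_
            rw [Finset.sum_eq_single j]
            · rw [hs, if_pos rfl]
            · intro l _ hl; rw [hs, if_neg (Ne.symm hl)]; simp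
            · simp
      _ = _ := by
            rw [← Finset.sum_smul, ← hv, smul_smul]
            congr 1; ring
  rw [cliffForm_apply, Algebra.algebraMap_eq_smul_one]
  have h2 : (2 : ℝ) • (M.cliffordMul v * M.cliffordMul v) =
      (2 : ℝ) • ((-⟪v, v⟫_ℝ) • (1 : SpinorMatrix k)) := by
    rw [two_smul, hadd, smul_smul]; congr 1; ring
  exact smul_right_injective _ (two_ne_zero) h2

/-- The action of the Clifford algebra on the spinor module. -/
def cliffordRep : Cl V →ₐ[ℝ] SpinorMatrix k :=
  CliffordAlgebra.lift (cliffForm V) ⟨M.cliffordMul, M.cliffordMul_sq⟩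

theorem cliffordRep_vec (v : V) : M.cliffordRep (vec v) = M.cliffordMul v := by
  simp [cliffordRep, vec]

/-- Smooth spinors on `V / Γ`, i.e. smooth sections of the bundle
`(V × Spinor k) / Γ`, `γ (x, u) = (γ x, ĥ(γ) u)`, viewed as `Γ`-equivariant functions on `V`. -/
def spinors (σ : M.SpinStructure) : Submodule ℂ (V → Spinor k) where
  carrier := {ψ | ContDiff ℝ ∞ ψ ∧ ∀ (γ : M.deck) (x : V),
    ψ ((γ : V ≃ᵃⁱ[ℝ] V) x) = M.cliffordRep (σ.lift γ : Cl V) *ᵥ ψ x}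
  zero_mem' := ⟨contDiff_const, fun γ x => by simp⟩
  add_mem' := fun {φ ψ} hφ hψ => ⟨hφ.1.add hψ.1, fun γ x => by
    simp only [Pi.add_apply, hφ.2 γ x, hψ.2 γ x, Matrix.mulVec_add]⟩
  smul_mem' := fun c ψ hψ => ⟨hψ.1.const_smul c, fun γ x => by
    simp only [Pi.smul_apply, hψ.2 γ x, Matrix.mulVec_smul]⟩

/-- The Dirac operator `D ψ = ∑ⱼ eⱼ · ∂ψ/∂xⱼ` of the flat metric. -/
def dirac (ψ : V → Spinor k) (x : V) : Spinor k :=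
  ∑ j, M.cliffordRep (vec (M.e j)) *ᵥ fderiv ℝ ψ x (M.e j)

/-- The eigenspace of the Dirac operator on `V / Γ` for the real number `l`. -/
def eigenspace (σ : M.SpinStructure) (l : ℝ) : Submodule ℂ (V → Spinor k) where
  carrier := {ψ | ψ ∈ M.spinors σ ∧ ∀ x, M.dirac ψ x = (l : ℂ) • ψ x}
  zero_mem' := ⟨zero_mem _, fun x => by simp [dirac]⟩
  add_mem' := fun {φ ψ} hφ hψ => ⟨add_mem hφ.1 hψ.1, fun x => by
    have h1 := (hφ.1.1.differentiable (by simp)) x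
    have h2 := (hψ.1.1.differentiable (by simp)) x
    have h3 := hφ.2 x
    have h4 := hψ.2 x
    simp only [dirac] at h3 h4 ⊢
    rw [fderiv_add h1 h2]
    simp only [add_apply, Matrix.mulVec_add, Finset.sum_add_distrib, h3, h4,
      Pi.add_apply, smul_add]⟩
  smul_mem' := fun c ψ hψ => ⟨Submodule.smul_mem _ c hψ.1, fun x => by
    have h1 := (hψ.1.1.differentiable (by simp)) x
    have h3 := hψ.2 x
    simp only [dirac] at h3 ⊢
    rw [fderiv_const_smul h1]
    simp only [smul_apply, Matrix.mulVec_smul, ← Finset.smul_sum, h3,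
      Pi.smul_apply]
    rw [smul_comm]⟩

/-- `IsEtaInvariant σ c` says that `c` is the eta invariant of the Dirac operator on `V / Γ` with
the spin structure `σ`: every eigenvalue has finite multiplicity, the series
`∑ sgn(l) |l| ^ (-z)` over the nonzero eigenvalues `l`, repeated according to multiplicity,
converges (absolutely) for `re z` sufficiently large, it has a meromorphic extension to the
complex plane that is regular at `0`, and the value of the extension at `0` is `c`. -/
def IsEtaInvariant (σ : M.SpinStructure) (c : ℂ) : Prop :=
  (∀ l : ℝ, FiniteDimensional ℂ (M.eigenspace σ l)) ∧
  ∃ η : ℂ → ℂ, Meromorphic η ∧ AnalyticAt ℂ η 0 ∧ η 0 = c ∧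
    ∃ R : ℝ, ∀ z : ℂ, R < z.re →
      HasSum (fun l : ℝ => (Module.finrank ℂ (M.eigenspace σ l) : ℂ) *
        ((Real.sign l : ℝ) : ℂ) * ((|l| : ℝ) : ℂ) ^ (-z)) (η z)

end CHDManifold
end FlatCHD
end

noncomputable section

/-! ### Fourier series of lattice-periodic functions -/

section PeriodicFourier

set_option linter.unusedSectionVars false

open MeasureTheory UnitAddTorus

variable {ι E : Type*} [Fintype ι] [NormedAddCommGroup E] [NormedSpace ℝ E]

/-! Write `n = 2k + 1`, and let `R` be the action on spinors of the chosen lift `y` of `A`. Since `A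
^ n = 1` and `R ^ (2n) = 1`, a spinor is periodic under `a₁, …, aₙ₋₁, 2aₙ`, so it has a Fourier
expansion with coefficients `c ξ`. The Dirac equation becomes `i ξ · c ξ = l c ξ`. Since `(i ξ) ^ 2
= ‖ξ‖ ^ 2`, only the finitely many frequencies with `‖ξ‖ = |l|` occur, and eigenspaces are
finite-dimensional spaces of trigonometric polynomials (`eigenspace_eq_map`). Equivariance under `g`
relates `c (A ξ)` to `R c ξ`.

Split the frequencies according to whether the component `β` of `ξ` orthogonal to `eₙ` vanishes.
Where it does not, the matrix `eₙ β` is invertible, anticommutes with `ξ` and is compatible with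
`R`. It therefore exchanges the eigenvalues `l` and `-l`, and these frequencies contribute nothing
to the eta series (`finrank_mixedSpace_neg`).

On the multiples of `eₙ`, which `A` fixes, a tensor basis of eigenvectors of `T` diagonalizes both
`eₙ` and `R`. The vector indexed by a sign pattern `s` has `eₙ`-eigenvalue `i ε` with `ε = ±1`, and
`R`-eigenvalue `exp (i π (w / n + q))` with `w = weight s`; the parity of `q` selects the lift. It
carries exactly the eigenvalues `2 π n (m + x)`, with `m` an integer and `x = -ε (w / n + q) / 2`
(`finrank_verticalSpace`). Hence the eta function is a finite sum of odd Hurwitz zeta functions,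
which are entire (`exists_hasSum_etaFun`).

The doubled odd Hurwitz zeta function at `0` is `1 - 2x` for `0 < x < 1` and vanishes for integral
`x` (`hurwitzZetaOdd_zero`). Passing to the other lift moves each `x` by `1/2` modulo `1`, so each
`s` changes eta by `-1`, `0` or `1` (`exists_int_etaJump`). Reversing all signs in `s` replaces `x`
by `x` or `-x` modulo `1`, which preserves the jump up to sign (`shift_flipSigns`). For `k > 0` the
sign patterns thus form pairs with even total jump; for `k = 0` the only jump is its own negative,
hence zero. -/

/-- The product of the probability Haar measures of the circles. -/
abbrev torusHaar (ι : Type*) [Fintype ι] : Measure (UnitAddTorus ι) :=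
  Measure.pi fun _ => AddCircle.haarAddCircle

theorem mFourierCoeff_eq_torusHaar (F : UnitAddTorus ι → ℂ) (m : ι → ℤ) :
    mFourierCoeff F m = ∫ θ, mFourier (-m) θ • F θ ∂(torusHaar ι) := rfl

/-- The coordinates modulo `1`. -/
def torusMk (x : ι → ℝ) : UnitAddTorus ι := fun i => (x i : UnitAddCircle)

theorem isOpenQuotientMap_torusMk : IsOpenQuotientMap (torusMk : (ι → ℝ) → UnitAddTorus ι) :=
  IsOpenQuotientMap.piMap fun _ => QuotientAddGroup.isOpenQuotientMap_mk

theorem torusMk_add (x y : ι → ℝ) : torusMk (x + y) = torusMk x + torusMk y := rfl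

theorem mFourier_torusMk (m : ι → ℤ) (x : ι → ℝ) :
    mFourier m (torusMk x) = Complex.exp (2 * Real.pi * Complex.I * ∑ i, (m i : ℂ) * x i) := by
  simp only [mFourier, ContinuousMap.coe_mk, torusMk]
  rw [Finset.mul_sum, Complex.exp_sum]
  refine Finset.prod_congr rfl fun i _ => ?_
  rw [fourier_coe_apply]
  congr 1
  push_cast
  ring

/-- A function which is periodic with respect to the lattice spanned by a basis. -/
def IsPeriodic {F : Type*} (b : Module.Basis ι ℝ E) (f : E → F) : Prop :=
  ∀ i x, f (x + b i) = f x

/-- The function on the torus induced by a periodic function. -/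
def torusLift {F : Type*} (b : Module.Basis ι ℝ E) (f : E → F) (θ : UnitAddTorus ι) : F :=
  f (∑ i, (θ i).out • b i)

theorem IsPeriodic.add_int_smul {F : Type*} {b : Module.Basis ι ℝ E} {f : E → F}
    (hf : IsPeriodic b f) (i : ι) (z : ℤ) (x : E) : f (x + (z : ℝ) • b i) = f x := by
  induction z using Int.induction_on with
  | zero => simp
  | succ n ih =>
    rw [← ih, ← hf i (x + ((n : ℤ) : ℝ) • b i)]
    congr 1; push_cast; module
  | pred n ih =>
    rw [← ih, ← hf i]
    congr 1; push_cast; module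

theorem IsPeriodic.add_sum_int_smul {F : Type*} {b : Module.Basis ι ℝ E} {f : E → F}
    (hf : IsPeriodic b f) (z : ι → ℤ) (s : Finset ι) (x : E) :
    f (x + ∑ i ∈ s, (z i : ℝ) • b i) = f x := by
  classical
  induction s using Finset.induction_on with
  | empty => simp
  | insert i s hi ih => rw [Finset.sum_insert hi, add_comm (_ • _), ← add_assoc,
      hf.add_int_smul, ih]

/-- The representatives chosen by `Quotient.out` differ from the given coordinates by integers,
which periodicity absorbs. -/
theorem torusLift_torusMk {F : Type*} {b : Module.Basis ι ℝ E} {f : E → F} (hf : IsPeriodic b f)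
    (x : ι → ℝ) : torusLift b f (torusMk x) = f (∑ i, x i • b i) := by
  have h : ∀ i, ∃ z : ℤ, x i = (torusMk x i).out + z := fun i => by
    have h1 : ((torusMk x i).out : UnitAddCircle) = (x i : UnitAddCircle) :=
      Quotient.out_eq _
    obtain ⟨z, hz⟩ := (AddCircle.coe_eq_zero_iff (1 : ℝ)
      (x := x i - (torusMk x i).out)).1 (by rw [AddCircle.coe_sub, h1, sub_self])
    exact ⟨z, by rw [zsmul_one] at hz; linarith⟩
  choose z hz using h
  rw [torusLift, ← hf.add_sum_int_smul z Finset.univ]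
  congr 1
  rw [← Finset.sum_add_distrib]
  exact Finset.sum_congr rfl fun i _ => by rw [← add_smul, ← hz]

theorem continuous_torusLift {F : Type*} [TopologicalSpace F] {b : Module.Basis ι ℝ E} {f : E → F}
    (hf : IsPeriodic b f) (hc : Continuous f) : Continuous (torusLift b f) := by
  rw [← isOpenQuotientMap_torusMk.continuous_comp_iff]
  have : torusLift b f ∘ torusMk = fun x => f (∑ i, x i • b i) :=
    funext fun x => torusLift_torusMk hf x
  rw [this]
  fun_prop

/-- Fourier coefficients of a periodic function. -/
def periodicCoeff (b : Module.Basis ι ℝ E) (f : E → ℂ) (m : ι → ℤ) : ℂ :=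
  mFourierCoeff (torusLift b f) m

theorem integrable_torus {F : UnitAddTorus ι → ℂ} (hF : Continuous F) :
    Integrable F (torusHaar ι) :=
  hF.integrable_of_hasCompactSupport (HasCompactSupport.of_compactSpace F)

theorem periodicCoeff_sum {κ : Type*} (b : Module.Basis ι ℝ E) (s : Finset κ) (c : κ → ℂ)
    (f : κ → E → ℂ) (hf : ∀ j, IsPeriodic b (f j)) (hc : ∀ j, Continuous (f j)) (m : ι → ℤ) :
    periodicCoeff b (fun x => ∑ j ∈ s, c j * f j x) m = ∑ j ∈ s, c j * periodicCoeff b (f j) m := by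
  simp only [periodicCoeff, mFourierCoeff_eq_torusHaar]
  have h : ∀ θ, mFourier (-m) θ • torusLift b (fun x => ∑ j ∈ s, c j * f j x) θ =
      ∑ j ∈ s, c j * (mFourier (-m) θ • torusLift b (f j) θ) := fun θ => by
    simp only [torusLift, smul_eq_mul, Finset.mul_sum]
    exact Finset.sum_congr rfl fun j _ => by ring
  simp only [h]
  rw [integral_finsetSum]
  · simp only [integral_const_mul]
  · intro j _
    exact (integrable_torus ((mFourier (-m)).continuous.smul
      (continuous_torusLift (hf j) (hc j)))).const_mul _

theorem periodicCoeff_congr (b : Module.Basis ι ℝ E) {f g : E → ℂ} (h : ∀ x, f x = g x)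
    (m : ι → ℤ) : periodicCoeff b f m = periodicCoeff b g m := by rw [funext h]

/-- Differentiate at `t = 0` the coefficient of the translate of `f` by `t v`, in two ways: under
the integral sign, and after a translation-invariant change of variable that turns the translate
into an explicit exponential factor. Continuity of `f'` suffices; no integration by parts is needed.
-/
theorem periodicCoeff_deriv {b : Module.Basis ι ℝ E} {f f' : E → ℂ} (hf : IsPeriodic b f)
    (hc : Continuous f) (hf' : IsPeriodic b f') (hc' : Continuous f') {v : E}
    (hd : ∀ x, HasDerivAt (fun t : ℝ => f (x + t • v)) (f' x) 0) (m : ι → ℤ) :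
    periodicCoeff b f' m =
      (2 * Real.pi * Complex.I * ∑ i, (m i : ℂ) * b.repr v i) * periodicCoeff b f m := by
  set F := torusLift b f
  set F' := torusLift b f'
  have hF : Continuous F := continuous_torusLift hf hc
  have hF' : Continuous F' := continuous_torusLift hf' hc'
  set w : ι → ℝ := fun i => b.repr v i
  have hv : v = ∑ i, w i • b i := (b.sum_repr v).symm
  have hder : ∀ θ (t : ℝ), HasDerivAt (fun t : ℝ => F (θ + torusMk (t • w)))
      (F' (θ + torusMk (t • w))) t := by
    intro θ t
    obtain ⟨x, rfl⟩ := isOpenQuotientMap_torusMk.surjective θ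
    have hx : ∀ s : ℝ, ∑ i, (x + s • w) i • b i = ∑ i, x i • b i + s • v := fun s => by
      conv_rhs => rw [hv]
      simp only [Pi.add_apply, Pi.smul_apply, add_smul, Finset.sum_add_distrib, Finset.smul_sum,
        smul_eq_mul, mul_smul]
    have h1 : ∀ s : ℝ, F (torusMk x + torusMk (s • w)) = f (∑ i, x i • b i + s • v) := fun s => by
      rw [← torusMk_add, ← hx]; exact torusLift_torusMk hf _
    have h2 : F' (torusMk x + torusMk (t • w)) = f' (∑ i, x i • b i + t • v) := by
      rw [← torusMk_add, ← hx]; exact torusLift_torusMk hf' _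
    simp only [h1, h2]
    have h3 := hd (∑ i, x i • b i + t • v)
    have h4 : HasDerivAt (fun s : ℝ => s - t) 1 t := (hasDerivAt_id t).sub_const t
    have h5 := HasDerivAt.scomp_of_eq t h3 h4 (by simp)
    rw [one_smul] at h5
    refine h5.congr_of_eventuallyEq (Filter.Eventually.of_forall fun s => ?_)
    simp only [Function.comp]
    congr 1
    module
  -- The torus is compact, so a constant dominates the derivative of the integrand for all `t`.
  obtain ⟨K, hK⟩ := (isCompact_range hF'.norm).bddAbove
  have hmeas : ∀ t : ℝ, Continuous fun θ => mFourier (-m) θ * F (θ + torusMk (t • w)) := fun t =>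
    (mFourier (-m)).continuous.mul (hF.comp (by fun_prop))
  have hmeas' : Continuous fun θ => mFourier (-m) θ * F' (θ + torusMk ((0 : ℝ) • w)) :=
    (mFourier (-m)).continuous.mul (hF'.comp (by fun_prop))
  have key := (hasDerivAt_integral_of_dominated_loc_of_deriv_le (μ := torusHaar ι)
    (F := fun t θ => mFourier (-m) θ * F (θ + torusMk (t • w)))
    (F' := fun t θ => mFourier (-m) θ * F' (θ + torusMk (t • w))) (x₀ := (0 : ℝ))
    (bound := fun _ => K) (s := Set.univ) Filter.univ_mem
    (Filter.Eventually.of_forall fun t => (integrable_torus (hmeas t)).aestronglyMeasurable)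
    (integrable_torus (hmeas 0)) (integrable_torus hmeas').aestronglyMeasurable
    (Filter.Eventually.of_forall fun θ t _ => by
      rw [norm_mul]
      have h1 : ‖mFourier (-m) θ‖ ≤ 1 :=
        (ContinuousMap.norm_coe_le_norm _ _).trans mFourier_norm.le
      have h2 : ‖F' (θ + torusMk (t • w))‖ ≤ K := hK ⟨_, rfl⟩
      calc _ ≤ 1 * K := mul_le_mul h1 h2 (norm_nonneg _) zero_le_one
        _ = K := one_mul K)
    (integrable_const K)
    (Filter.Eventually.of_forall fun θ t _ => (hder θ t).const_mul _)).2
  -- Translation invariance of Haar measure.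
  have hshift : ∀ t : ℝ, ∫ θ, mFourier (-m) θ * F (θ + torusMk (t • w)) ∂(torusHaar ι) =
      Complex.exp ((t : ℂ) * (2 * Real.pi * Complex.I * ∑ i, (m i : ℂ) * w i)) *
        periodicCoeff b f m := by
    intro t
    rw [periodicCoeff, mFourierCoeff_eq_torusHaar, ← integral_const_mul,
      ← integral_add_right_eq_self (fun θ => _ * (mFourier (-m) θ • torusLift b f θ))
        (torusMk (t • w))]
    refine integral_congr_ae (Filter.Eventually.of_forall fun θ => ?_)
    obtain ⟨x, rfl⟩ := isOpenQuotientMap_torusMk.surjective θ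
    simp only [smul_eq_mul, ← torusMk_add, mFourier_torusMk]
    rw [← mul_assoc, ← Complex.exp_add]
    congr 2
    simp only [Pi.neg_apply, Pi.add_apply, Pi.smul_apply, smul_eq_mul, Finset.mul_sum]
    rw [← Finset.sum_add_distrib]
    refine Finset.sum_congr rfl fun i _ => ?_
    push_cast
    ring
  simp only [hshift] at key
  have h6 : HasDerivAt (fun t : ℝ => Complex.exp ((t : ℂ) *
      (2 * Real.pi * Complex.I * ∑ i, (m i : ℂ) * w i)) * periodicCoeff b f m)
      ((2 * Real.pi * Complex.I * ∑ i, (m i : ℂ) * w i) * periodicCoeff b f m) 0 := by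
    have h7 : HasDerivAt (fun t : ℝ => (t : ℂ) *
      (2 * Real.pi * Complex.I * ∑ i, (m i : ℂ) * w i))
      (1 * (2 * Real.pi * Complex.I * ∑ i, (m i : ℂ) * w i)) 0 :=
      (Complex.ofRealCLM.hasDerivAt (x := (0 : ℝ))).mul_const _
    have h8 := (h7.cexp).mul_const (periodicCoeff b f m)
    simpa using h8
  have h9 := key.unique h6
  rw [← h9, periodicCoeff, mFourierCoeff_eq_torusHaar]
  refine integral_congr_ae (Filter.Eventually.of_forall fun θ => ?_)
  have h0 : torusMk ((0 : ℝ) • w) = 0 := by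
    funext i; simp [torusMk]
  simp only [h0, add_zero, smul_eq_mul]
  rfl

/-- A continuous periodic function with finitely many nonzero Fourier coefficients is a
trigonometric polynomial. -/
theorem eq_sum_of_periodicCoeff_eq_zero {b : Module.Basis ι ℝ E} {f : E → ℂ}
    (hf : IsPeriodic b f) (hc : Continuous f) (s : Finset (ι → ℤ))
    (hs : ∀ m ∉ s, periodicCoeff b f m = 0) (x : E) :
    f x = ∑ m ∈ s, Complex.exp (2 * Real.pi * Complex.I * ∑ i, (m i : ℂ) * b.repr x i) *
      periodicCoeff b f m := by
  let F : C(UnitAddTorus ι, ℂ) := ⟨torusLift b f, continuous_torusLift hf hc⟩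
  have h0 : ∀ m ∉ s, mFourierCoeff F m = 0 := hs
  have h1 := hasSum_mFourier_series_apply_of_summable (f := F)
    (summable_of_ne_finset_zero (s := s) h0) (torusMk fun i => b.repr x i)
  have h2 : HasSum _ _ := hasSum_sum_of_ne_finset_zero (s := s)
    (f := fun m => mFourierCoeff F m • mFourier m (torusMk fun i => b.repr x i))
    (fun m hm => by rw [h0 m hm, zero_smul])
  have h3 : F (torusMk fun i => b.repr x i) = f x := by
    change torusLift b f _ = _
    rw [torusLift_torusMk hf, b.sum_repr]
  rw [← h3, h1.unique h2]
  refine Finset.sum_congr rfl fun m _ => ?_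
  rw [mFourier_torusMk, smul_eq_mul, mul_comm]
  rfl

end PeriodicFourier
end

noncomputable section

/-! ### The odd Hurwitz zeta function at `0` -/

section HurwitzZero

open HurwitzZeta

theorem hasDerivAt_ofReal_cpow_neg {t : ℝ} (ht : 0 < t) (s : ℂ) :
    HasDerivAt (fun t : ℝ => (t : ℂ) ^ (-s)) (-s * (t : ℂ) ^ (-(s + 1))) t := by
  have h1 : HasDerivAt (fun z : ℂ => z ^ (-s)) (-s * (t : ℂ) ^ (-s - 1) * 1) (t : ℂ) :=
    (hasDerivAt_id (t : ℂ)).cpow_const (Or.inl (by simpa using ht))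
  have h2 := h1.comp_ofReal
  rw [mul_one, show -s - 1 = -(s + 1) by ring] at h2
  exact h2

/-- First order Taylor estimate for `t ↦ t ^ (-s)` on `[a, a + 1]`. -/
theorem norm_cpow_taylor_le {a x : ℝ} (ha : 0 < a) (hx : x ∈ Set.Icc (0 : ℝ) 1) {s : ℂ}
    (hs : -2 ≤ s.re) :
    ‖((a + x : ℝ) : ℂ) ^ (-s) - (a : ℂ) ^ (-s) - x * (-s * (a : ℂ) ^ (-(s + 1)))‖ ≤
      ‖s‖ * ‖s + 1‖ * a ^ (-(s.re + 2)) := by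
  set C := ‖s‖ * ‖s + 1‖ * a ^ (-(s.re + 2)) with hC
  have hC0 : 0 ≤ C := by positivity
  have hpos : ∀ t ∈ Set.Icc a (a + 1), 0 < t := fun t ht => ha.trans_le ht.1
  have hmem : a ∈ Set.Icc a (a + 1) := ⟨le_rfl, by linarith⟩
  -- The mean value inequality is used twice: here on the derivative, where `C` bounds the second
  -- derivative on the interval, and then in `h2` on the function minus its tangent line.
  have h1 : ∀ t ∈ Set.Icc a (a + 1),
      ‖-s * (t : ℂ) ^ (-(s + 1)) - -s * (a : ℂ) ^ (-(s + 1))‖ ≤ C := by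
    intro t ht
    have h := (convex_Icc a (a + 1)).norm_image_sub_le_of_norm_hasDerivWithin_le (C := C)
      (f := fun t : ℝ => -s * (t : ℂ) ^ (-(s + 1)))
      (f' := fun t : ℝ => -s * (-(s + 1) * (t : ℂ) ^ (-(s + 1 + 1))))
      (fun u hu => ((hasDerivAt_ofReal_cpow_neg (hpos u hu) (s + 1)).const_mul _).hasDerivWithinAt)
      (fun u hu => by
        rw [norm_mul, norm_mul, norm_neg, norm_neg, Complex.norm_cpow_eq_rpow_re_of_pos (hpos u hu),
          ← mul_assoc, hC]
        refine mul_le_mul_of_nonneg_left ?_ (by positivity)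
        have : (-(s + 1 + 1)).re = -(s.re + 2) := by simp; ring
        rw [this]
        exact Real.rpow_le_rpow_of_nonpos ha hu.1 (by linarith)) hmem ht
    refine h.trans ?_
    have : ‖t - a‖ ≤ 1 := by
      rw [Real.norm_eq_abs, abs_of_nonneg (by linarith [ht.1])]; linarith [ht.2]
    nlinarith
  have h2 := (convex_Icc a (a + 1)).norm_image_sub_le_of_norm_hasDerivWithin_le (C := C)
      (f := fun t : ℝ => (t : ℂ) ^ (-s) - (t : ℂ) * (-s * (a : ℂ) ^ (-(s + 1))))
      (f' := fun t : ℝ => -s * (t : ℂ) ^ (-(s + 1)) - 1 * (-s * (a : ℂ) ^ (-(s + 1))))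
      (x := a) (y := a + x)
      (fun u hu => ((hasDerivAt_ofReal_cpow_neg (hpos u hu) s).sub
        ((Complex.ofRealCLM.hasDerivAt (x := u)).mul_const _)).hasDerivWithinAt)
      (fun u hu => by rw [one_mul]; exact h1 u hu) hmem ⟨by linarith [hx.1], by linarith [hx.2]⟩
  have h3 : ‖a + x - a‖ ≤ 1 := by
    rw [add_sub_cancel_left, Real.norm_eq_abs, abs_of_nonneg hx.1]; exact hx.2
  refine le_trans (le_of_eq ?_) (h2.trans (by nlinarith))
  congr 1
  push_cast
  ring

/-- The summands of the series continuing the odd Hurwitz zeta function. -/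
def hurwitzTerm (x : ℝ) (n : ℕ) (s : ℂ) : ℂ :=
  (((n : ℝ) + 1 + x : ℝ) : ℂ) ^ (-s) - (((n : ℝ) + 1 + (1 - x) : ℝ) : ℂ) ^ (-s) -
    (1 - 2 * x) * ((((n : ℝ) + 1 : ℝ) : ℂ) ^ (-s) - (((n : ℝ) + 1 + 1 : ℝ) : ℂ) ^ (-s))

/-- The last difference in `hurwitzTerm` is weighted so that the first-order terms at `n + 1`
cancel. Only second-order remainders survive, which gains a factor of order `n ^ (-2)`. -/
theorem norm_hurwitzTerm_le {x : ℝ} (hx : x ∈ Set.Icc (0 : ℝ) 1) (n : ℕ) {s : ℂ}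
    (hs : -2 ≤ s.re) :
    ‖hurwitzTerm x n s‖ ≤ 3 * (‖s‖ * ‖s + 1‖ * ((n : ℝ) + 1) ^ (-(s.re + 2))) := by
  have ha : (0 : ℝ) < (n : ℝ) + 1 := by positivity
  have h1 := norm_cpow_taylor_le ha hx hs
  have h2 := norm_cpow_taylor_le ha (x := 1 - x) ⟨by linarith [hx.2], by linarith [hx.1]⟩ hs
  have h3 := norm_cpow_taylor_le ha (x := 1) ⟨zero_le_one, le_rfl⟩ hs
  set R1 := (((n : ℝ) + 1 + x : ℝ) : ℂ) ^ (-s) - (((n : ℝ) + 1 : ℝ) : ℂ) ^ (-s) -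
    x * (-s * (((n : ℝ) + 1 : ℝ) : ℂ) ^ (-(s + 1))) with hR1
  set R2 := (((n : ℝ) + 1 + (1 - x) : ℝ) : ℂ) ^ (-s) - (((n : ℝ) + 1 : ℝ) : ℂ) ^ (-s) -
    ((1 - x : ℝ) : ℂ) * (-s * (((n : ℝ) + 1 : ℝ) : ℂ) ^ (-(s + 1))) with hR2
  set R3 := (((n : ℝ) + 1 + 1 : ℝ) : ℂ) ^ (-s) - (((n : ℝ) + 1 : ℝ) : ℂ) ^ (-s) -
    ((1 : ℝ) : ℂ) * (-s * (((n : ℝ) + 1 : ℝ) : ℂ) ^ (-(s + 1))) with hR3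
  -- The linear parts cancel because `x - (1 - x) + (1 - 2x) = 0`.
  have h4 : hurwitzTerm x n s = R1 - R2 + (1 - 2 * x : ℝ) * R3 := by
    rw [hurwitzTerm, hR1, hR2, hR3]; push_cast; ring
  have h5 : ‖((1 - 2 * x : ℝ) : ℂ)‖ ≤ 1 := by
    rw [Complex.norm_real, Real.norm_eq_abs, abs_le]
    constructor <;> linarith [hx.1, hx.2]
  have h6 : ‖((1 - 2 * x : ℝ) : ℂ) * R3‖ ≤ 1 * ‖R3‖ := by
    rw [norm_mul]; exact mul_le_mul_of_nonneg_right h5 (norm_nonneg _)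
  rw [h4]
  linarith [norm_add_le (R1 - R2) (((1 - 2 * x : ℝ) : ℂ) * R3), norm_sub_le R1 R2]

theorem hasSum_cpow_telescope {s : ℂ} (hs : 1 < s.re) :
    HasSum (fun n : ℕ => (((n : ℝ) + 1 : ℝ) : ℂ) ^ (-s) - (((n : ℝ) + 1 + 1 : ℝ) : ℂ) ^ (-s)) 1 := by
  set f : ℕ → ℂ := fun n => (((n : ℝ) + 1 : ℝ) : ℂ) ^ (-s) with hf
  have h1 : Summable f := by
    have h := (summable_nat_add_iff 1).2 (Complex.summable_one_div_nat_cpow.2 hs)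
    refine h.congr fun n => ?_
    rw [hf]; push_cast; rw [Complex.cpow_neg, one_div]
  have h2 : HasSum (fun n => f (n + 1)) (∑' n, f n - f 0) := by
    simpa using (hasSum_nat_add_iff' 1).2 h1.hasSum
  have h3 := h1.hasSum.sub h2
  have h4 : f 0 = 1 := by simp [hf]
  rw [sub_sub_cancel, h4] at h3
  refine h3.congr_fun fun n => ?_
  simp [hf]

/-- The first summand of the Dirichlet series is split off, and a telescoping series of total `1 -
2x` is subtracted from the rest to improve convergence. -/
theorem two_mul_hurwitzZetaOdd_eq_of_one_lt_re {x : ℝ} (hx : x ∈ Set.Ioo (0 : ℝ) 1) {s : ℂ}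
    (hs : 1 < s.re) : 2 * hurwitzZetaOdd x s =
      (x : ℂ) ^ (-s) - ((1 - x : ℝ) : ℂ) ^ (-s) + (1 - 2 * x) + ∑' n, hurwitzTerm x n s := by
  have h1 := (hasSum_nat_hurwitzZetaOdd_of_mem_Icc (Set.Ioo_subset_Icc_self hx) hs).mul_left 2
  have h2 := (hasSum_nat_add_iff' 1).2 h1
  have h3 := h2.sub ((hasSum_cpow_telescope hs).mul_left (1 - 2 * (x : ℂ)))
  have h4 : HasSum (fun n => hurwitzTerm x n s) _ := h3.congr_fun fun n => by
    rw [hurwitzTerm, Complex.cpow_neg, Complex.cpow_neg ((_ + (1 - x) : ℝ) : ℂ)]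
    push_cast
    rw [show (n : ℂ) + 1 + (1 - x) = (n : ℂ) + 1 + 1 - x by ring]
    ring
  rw [h4.tsum_eq]
  simp only [Finset.range_one, Finset.sum_singleton, Complex.cpow_neg]
  push_cast
  simp
  ring

/-- The accelerated series still converges near `0`, so the identity theorem extends the preceding
formula there. At `0` every term of the series vanishes and only the telescoped constant remains. -/
theorem hurwitzZetaOdd_zero {x : ℝ} (hx : x ∈ Set.Ioo (0 : ℝ) 1) :
    2 * hurwitzZetaOdd x 0 = 1 - 2 * x := by
  -- Connected and containing both `2`, where the formula is known, and `0`. The bound on `‖s‖`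
  -- makes the majorant uniform.
  set U : Set ℂ := {s : ℂ | -(1 / 2) < s.re} ∩ Metric.ball 0 4 with hU
  have hUo : IsOpen U := (isOpen_lt continuous_const Complex.continuous_re).inter Metric.isOpen_ball
  have hUc : IsPreconnected U :=
    ((convex_halfSpace_re_gt _).inter (convex_ball (0 : ℂ) 4)).isPreconnected
  have hbase : ∀ a : ℝ, 0 < a → Differentiable ℂ fun s : ℂ => (a : ℂ) ^ (-s) := fun a ha =>
    differentiable_neg.const_cpow (Or.inl (by exact_mod_cast ha.ne'))
  have hterm : ∀ n, Differentiable ℂ (hurwitzTerm x n) := fun n =>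
    ((hbase _ (by linarith [hx.1, n.cast_nonneg (α := ℝ)])).sub
      (hbase _ (by linarith [hx.2, n.cast_nonneg (α := ℝ)]))).sub
      (((hbase _ (by positivity)).sub (hbase _ (by positivity))).const_mul _)
  -- `60 = 3 * 4 * 5`, from `‖s‖ < 4` and `‖s + 1‖ ≤ 5`; the exponent comes from `-1/2 < s.re`.
  have hsum : Summable fun n : ℕ => 60 * ((n : ℝ) + 1) ^ (-(3 / 2) : ℝ) := by
    have h := (summable_nat_add_iff 1).2 (Real.summable_nat_rpow.2 (by norm_num : (-(3 / 2) : ℝ) < -1))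
    exact (h.congr fun n => by push_cast; rfl).mul_left 60
  have hd : DifferentiableOn ℂ (fun s => ∑' n, hurwitzTerm x n s) U := by
    refine Complex.differentiableOn_tsum_of_summable_norm hsum (fun n => (hterm n).differentiableOn) hUo ?_
    rintro n s ⟨hs1, hs2⟩
    have hs1 : -(1 / 2) < s.re := hs1
    have hs2 : ‖s‖ < 4 := by simpa using hs2
    have hs3 : ‖s + 1‖ ≤ 5 := (norm_add_le _ _).trans (by rw [norm_one]; linarith)
    refine (norm_hurwitzTerm_le (Set.Ioo_subset_Icc_self hx) n (by linarith)).trans ?_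
    have h1 : ((n : ℝ) + 1) ^ (-(s.re + 2)) ≤ ((n : ℝ) + 1) ^ (-(3 / 2) : ℝ) :=
      Real.rpow_le_rpow_of_exponent_le (by linarith [n.cast_nonneg (α := ℝ)]) (by linarith)
    have h2 : ‖s‖ * ‖s + 1‖ ≤ 4 * 5 := mul_le_mul hs2.le hs3 (norm_nonneg _) (by norm_num)
    have h3 : 0 ≤ ((n : ℝ) + 1) ^ (-(s.re + 2)) := by positivity
    nlinarith [mul_le_mul h2 h1 h3 (by norm_num)]
  have hR : DifferentiableOn ℂ (fun s => (x : ℂ) ^ (-s) - ((1 - x : ℝ) : ℂ) ^ (-s) + (1 - 2 * x) +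
      ∑' n, hurwitzTerm x n s) U :=
    ((((hbase x hx.1).sub (hbase _ (by linarith [hx.2]))).add_const _).differentiableOn).add hd
  have hL : DifferentiableOn ℂ (fun s => 2 * hurwitzZetaOdd x s) U :=
    ((differentiable_hurwitzZetaOdd _).const_mul 2).differentiableOn
  have h2U : (2 : ℂ) ∈ U := ⟨by simp; norm_num, by simp; norm_num⟩
  have h0U : (0 : ℂ) ∈ U := ⟨by simp, by simp⟩
  have hev : (fun s => 2 * hurwitzZetaOdd x s) =ᶠ[nhds 2]
      (fun s => (x : ℂ) ^ (-s) - ((1 - x : ℝ) : ℂ) ^ (-s) + (1 - 2 * x) +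
      ∑' n, hurwitzTerm x n s) := by
    filter_upwards [(isOpen_lt continuous_const Complex.continuous_re).mem_nhds
      (show (1 : ℝ) < (2 : ℂ).re by simp)] with s hs
    exact two_mul_hurwitzZetaOdd_eq_of_one_lt_re hx hs
  have h := (hL.analyticOnNhd hUo).eqOn_of_preconnected_of_eventuallyEq (hR.analyticOnNhd hUo) hUc
    h2U hev h0U
  have ht : ∀ n, hurwitzTerm x n 0 = 0 := fun n => by simp [hurwitzTerm]
  simpa [ht] using h

theorem hurwitzZetaOdd_self_neg_zero {a : UnitAddCircle} (ha : -a = a) (s : ℂ) :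
    hurwitzZetaOdd a s = 0 := by
  have h := hurwitzZetaOdd_neg a s
  rw [ha] at h
  exact self_eq_neg.mp h

/-- Reduce to the fractional part. At `0` and `1/2` oddness makes both values vanish; elsewhere the
linear formula applies to both points, and the difference is `1` or `-1` according to whether adding
`1/2` stays below `1` or wraps around. -/
theorem exists_int_hurwitzZetaOdd_sub (x : ℝ) :
    ∃ d : ℤ, 2 * hurwitzZetaOdd x 0 - 2 * hurwitzZetaOdd ((x + 1 / 2 : ℝ) : UnitAddCircle) 0 = d := by
  have hper : ∀ (y : ℝ) (z : ℤ), ((y + z : ℝ) : UnitAddCircle) = y := fun y z => by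
    rw [AddCircle.coe_add, (AddCircle.coe_eq_zero_iff (1 : ℝ) (x := (z : ℝ))).2 ⟨z, by simp⟩,
      add_zero]
  have hx : x = Int.fract x + (⌊x⌋ : ℤ) := (Int.fract_add_floor x).symm
  have hx' : x + 1 / 2 = (Int.fract x + 1 / 2) + (⌊x⌋ : ℤ) := by linarith
  rw [hx', hper, hx, hper, ← hx]
  have h0 := Int.fract_nonneg x
  have h1 := Int.fract_lt_one x
  generalize Int.fract x = y at h0 h1
  have hz : hurwitzZetaOdd ((0 : ℝ) : UnitAddCircle) 0 = 0 :=
    hurwitzZetaOdd_self_neg_zero (by simp) 0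
  have hhalf : hurwitzZetaOdd ((1 / 2 : ℝ) : UnitAddCircle) 0 = 0 := by
    refine hurwitzZetaOdd_self_neg_zero ?_ 0
    rw [← AddCircle.coe_neg, ← hper (-(1 / 2)) 1]
    congr 1; norm_num
  rcases h0.eq_or_lt with rfl | h0
  · exact ⟨0, by rw [zero_add, hz, hhalf]; simp⟩
  rcases lt_trichotomy y (1 / 2) with h | rfl | h
  · refine ⟨1, ?_⟩
    rw [hurwitzZetaOdd_zero ⟨h0, h1⟩, hurwitzZetaOdd_zero ⟨by linarith, by linarith⟩]
    push_cast; ring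
  · refine ⟨0, ?_⟩
    rw [hhalf, show (1 / 2 + 1 / 2 : ℝ) = 0 + (1 : ℤ) by norm_num, hper, hz]; simp
  · refine ⟨-1, ?_⟩
    rw [show (y + 1 / 2 : ℝ) = (y - 1 / 2) + (1 : ℤ) by push_cast; ring, hper,
      hurwitzZetaOdd_zero ⟨h0, h1⟩, hurwitzZetaOdd_zero ⟨by linarith, by linarith⟩]
    push_cast; ring

end HurwitzZero
end

noncomputable section

namespace FlatCHD

/-! ### A joint eigenbasis of the spinor module -/

/-- The matrix whose columns are eigenvectors of `gT`. -/
def gU : Matrix (Fin 2) (Fin 2) ℂ := !![1, 1; Complex.I, -Complex.I]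

/-- The inverse of `gU`. -/
def gUinv : Matrix (Fin 2) (Fin 2) ℂ := !![1 / 2, -Complex.I / 2; 1 / 2, Complex.I / 2]

/-- The sign attached to an element of `Fin 2`. -/
def bitSign (a : Fin 2) : ℤ := if a = 0 then 1 else -1

theorem bitSign_mul_self (a : Fin 2) : bitSign a * bitSign a = 1 := by
  fin_cases a <;> simp [bitSign]

theorem gU_mul_gUinv : gU * gUinv = 1 := by
  ext i j; fin_cases i <;> fin_cases j <;>
    simp [gU, gUinv, Matrix.mul_apply, mul_div_assoc'] <;> first | norm_num; done | ring

theorem gT_mul_gU : gT * gU = gU * Matrix.diagonal fun a => (bitSign a : ℂ) := by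
  ext i j; fin_cases i <;> fin_cases j <;>
    simp [gU, gT, bitSign, Matrix.mul_apply, Matrix.diagonal]

theorem g1_mul_g2 : g1 * g2 = (-Complex.I) • gT := by
  ext i j; fin_cases i <;> fin_cases j <;> simp [g1, g2, gT, Matrix.mul_apply]

theorem tensorMatrix_diagonal {k : ℕ} (d : Fin k → Fin 2 → ℂ) :
    tensorMatrix (fun m => Matrix.diagonal (d m)) =
      Matrix.diagonal fun s : Fin k → Fin 2 => ∏ m, d m (s m) := by
  ext s t
  by_cases h : s = t
  · subst h; simp [tensorMatrix]
  · obtain ⟨m, hm⟩ := Function.ne_iff.mp h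
    rw [Matrix.diagonal_apply_ne _ h, tensorMatrix, Matrix.of_apply]
    exact Finset.prod_eq_zero (Finset.mem_univ m) (Matrix.diagonal_apply_ne _ hm)

/-- The matrix whose columns form the joint eigenbasis. -/
def eigenMatrix (k : ℕ) : SpinorMatrix k := tensorMatrix fun _ => gU

/-- The inverse of `eigenMatrix`. -/
def eigenMatrixInv (k : ℕ) : SpinorMatrix k := tensorMatrix fun _ => gUinv

theorem eigenMatrix_mul_inv (k : ℕ) : eigenMatrix k * eigenMatrixInv k = 1 := by
  rw [eigenMatrix, eigenMatrixInv, tensorMatrix_mul]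
  simp only [gU_mul_gUinv, tensorMatrix_one]

theorem eigenMatrix_inv_mul (k : ℕ) : eigenMatrixInv k * eigenMatrix k = 1 :=
  mul_eq_one_comm.mp (eigenMatrix_mul_inv k)

/-- The product of all signs. -/
def totalSign {k : ℕ} (s : Fin k → Fin 2) : ℤ := ∏ m, bitSign (s m)

theorem totalSign_mul_self {k : ℕ} (s : Fin k → Fin 2) : totalSign s * totalSign s = 1 := by
  rw [totalSign, ← Finset.prod_mul_distrib]
  simp [bitSign_mul_self]

/-- The weighted sum of the signs. -/
def weight {k : ℕ} (s : Fin k → Fin 2) : ℤ := -∑ j : Fin k, bitSign (s j.rev) * (j.val + 1)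

theorem gamma_last_mul_eigenMatrix (k : ℕ) : gamma (Fin.last (2 * k)) * eigenMatrix k =
    eigenMatrix k * Matrix.diagonal fun s => Complex.I * (totalSign s : ℂ) := by
  have h : gamma (Fin.last (2 * k)) = Complex.I • tensorMatrix (fun _ : Fin k => gT) := by
    have hf : gammaFactor (Fin.last (2 * k)) = fun _ : Fin k => gT := by
      funext m
      rw [gammaFactor, if_pos (by simp)]
    rw [gamma, hf, if_pos (by simp)]
  rw [h, eigenMatrix, smul_mul_assoc, tensorMatrix_mul]
  simp only [gT_mul_gU]
  rw [← tensorMatrix_mul, tensorMatrix_diagonal, ← mul_smul_comm]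
  congr 1
  ext s t
  by_cases h : s = t
  · subst h; simp [totalSign]
  · simp [h]

/-- The two vectors of a rotation plane have the same trailing factors `T`, which cancel since `T ^
2 = 1`. The surviving slot, counted from the end, is `j.rev`. -/
theorem gamma_mul_gamma_succ {k : ℕ} (j : Fin k) :
    gamma (⟨2 * j.val, by omega⟩ : Fin (2 * k + 1)) * gamma ⟨2 * j.val + 1, by omega⟩ =
      tensorMatrix fun m : Fin k => if m = j.rev then (-Complex.I) • gT else 1 := by
  have hj := j.isLt
  rw [gamma, gamma, if_neg (by simp only; omega), if_neg (by simp only; omega), one_smul, one_smul,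
    tensorMatrix_mul]
  congr 1
  funext m
  have h1 : (2 * j.val + 1) / 2 = j.val := by omega
  have h2 : 2 * j.val / 2 = j.val := by omega
  have h3 : m = j.rev ↔ m.val + j.val + 1 = k := by
    rw [Fin.ext_iff, Fin.val_rev]; omega
  have h4 : (2 * j.val + 1) % 2 = 1 := by omega
  have h5 : 2 * j.val % 2 = 0 := by omega
  simp only [gammaFactor, h1, h2, h3, h4, h5]
  split_ifs <;> first | omega | contradiction | simp [gT_sq, g1_mul_g2]

theorem gamma_mul_gamma_succ_mul_eigenMatrix {k : ℕ} (j : Fin k) :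
    gamma (⟨2 * j.val, by omega⟩ : Fin (2 * k + 1)) * gamma ⟨2 * j.val + 1, by omega⟩ *
        eigenMatrix k =
      eigenMatrix k * Matrix.diagonal fun s => -Complex.I * (bitSign (s j.rev) : ℂ) := by
  rw [gamma_mul_gamma_succ, eigenMatrix, tensorMatrix_mul]
  have h : ∀ m : Fin k, (if m = j.rev then (-Complex.I) • gT else 1) * gU =
      gU * Matrix.diagonal fun a : Fin 2 =>
        if m = j.rev then -Complex.I * (bitSign a : ℂ) else 1 := by
    intro m
    split_ifs
    · rw [smul_mul_assoc, gT_mul_gU, ← mul_smul_comm, ← Matrix.diagonal_smul]; rfl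
    · rw [one_mul, Matrix.diagonal_one, mul_one]
  simp only [h]
  rw [← tensorMatrix_mul, tensorMatrix_diagonal]
  congr 2
  funext s
  rw [Finset.prod_ite_eq' Finset.univ j.rev, if_pos (Finset.mem_univ _)]

theorem list_ofFn_prod_mul_of_diagonal {κ : Type*} [Fintype κ] [DecidableEq κ] {n : ℕ}
    (f : Fin n → Matrix κ κ ℂ) (P : Matrix κ κ ℂ) (d : Fin n → κ → ℂ)
    (h : ∀ j, f j * P = P * Matrix.diagonal (d j)) :
    (List.ofFn f).prod * P = P * Matrix.diagonal fun s => ∏ j, d j s := by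
  induction n with
  | zero => simp
  | succ n ih =>
    rw [List.ofFn_succ, List.prod_cons, mul_assoc, ih _ (fun j => d j.succ) fun j => h j.succ,
      ← mul_assoc, h 0, mul_assoc, Matrix.diagonal_mul_diagonal]
    simp only [Fin.prod_univ_succ]

/-! ### Action of the spin lifts in the joint eigenbasis -/

namespace CHDManifold

variable {k : ℕ} {V : Type*} [NormedAddCommGroup V] [InnerProductSpace ℝ V]
variable (M : CHDManifold k V)

/-- The product of the two plane vectors acts by `-i` times a sign, so the eigenvalue has the form
`cos θ ∓ i sin θ`. This is where the minus sign in `weight` comes from. -/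
theorem cliffordRep_r_mul_eigenMatrix (j : Fin k) : M.cliffordRep (M.r j) * eigenMatrix k =
    eigenMatrix k * Matrix.diagonal fun s => Complex.exp (Complex.I *
      ((-bitSign (s j.rev) * ((j.val + 1) * (Real.pi / (2 * k + 1))) : ℝ) : ℂ)) := by
  rw [r, map_add, map_smul, map_mul, cliffordRep_vec, cliffordRep_vec, cliffordMul_e,
    cliffordMul_e, add_mul, smul_mul_assoc, gamma_mul_gamma_succ_mul_eigenMatrix, AlgHom.commutes,
    Algebra.commutes, ← mul_smul_comm, ← mul_add]
  congr 1
  generalize ((j.val : ℝ) + 1) * (Real.pi / (2 * k + 1)) = θ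
  rw [Algebra.algebraMap_eq_smul_one, ← Matrix.diagonal_one]
  ext s t
  by_cases h : s = t
  · subst h
    simp only [Matrix.add_apply, Matrix.smul_apply, Matrix.diagonal_apply_eq]
    rw [mul_comm Complex.I, Complex.exp_mul_I]
    have hs : bitSign (s j.rev) = 1 ∨ bitSign (s j.rev) = -1 := by
      unfold bitSign; split_ifs <;> simp
    rcases hs with hs | hs <;> rw [hs] <;> simp
  · simp [h]

theorem cliffordRep_alpha_mul_eigenMatrix : M.cliffordRep M.alpha * eigenMatrix k =
    eigenMatrix k * Matrix.diagonal fun s =>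
      Complex.exp (Complex.I * ((Real.pi * (weight s / (2 * k + 1)) : ℝ) : ℂ)) := by
  rw [alpha, map_list_prod, List.map_ofFn,
    list_ofFn_prod_mul_of_diagonal (M.cliffordRep ∘ fun j => M.r j) _ _ M.cliffordRep_r_mul_eigenMatrix]
  congr 2
  funext s
  rw [← Complex.exp_sum, ← Finset.mul_sum, ← Complex.ofReal_sum]
  congr 3
  rw [weight]
  push_cast
  rw [neg_div, Finset.sum_div, mul_neg, Finset.mul_sum, ← Finset.sum_neg_distrib]
  exact Finset.sum_congr rfl fun j _ => by ring

/-- `IsLiftWithPhase y q` says that, in the joint eigenbasis, `y` acts as `exp (i π q) α`. -/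
def IsLiftWithPhase (y : Spin V) (q : ℤ) : Prop :=
  M.cliffordRep (y : Cl V) * eigenMatrix k = eigenMatrix k * Matrix.diagonal fun s =>
    Complex.exp (Complex.I * ((Real.pi * (weight s / (2 * k + 1) + q) : ℝ) : ℂ))

theorem exp_pi_add_int (t : ℝ) (q : ℤ) : Complex.exp (Complex.I * ((Real.pi * (t + q) : ℝ) : ℂ)) =
    (-1) ^ q * Complex.exp (Complex.I * ((Real.pi * t : ℝ) : ℂ)) := by
  have h : (-1 : ℂ) ^ q = Complex.exp (q * (Real.pi * Complex.I)) := by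
    rw [Complex.exp_int_mul, Complex.exp_pi_mul_I]
  rw [h, ← Complex.exp_add]
  congr 1
  push_cast
  ring

theorem isLiftWithPhase_of_eq_smul {y : Spin V} {q : ℤ}
    (h : M.cliffordRep (y : Cl V) = ((-1 : ℂ) ^ q) • M.cliffordRep M.alpha) :
    M.IsLiftWithPhase y q := by
  rw [IsLiftWithPhase, h, smul_mul_assoc, cliffordRep_alpha_mul_eigenMatrix, ← mul_smul_comm,
    ← Matrix.diagonal_smul]
  congr 2
  funext s
  rw [exp_pi_add_int]
  rfl

theorem isLiftWithPhase_alphaPlus : M.IsLiftWithPhase M.alphaPlus (k * (k + 1) / 2 : ℕ) := by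
  refine M.isLiftWithPhase_of_eq_smul ?_
  change M.cliffordRep ((-1) ^ (k * (k + 1) / 2) * M.alpha) = _
  rw [map_mul, map_pow, map_neg, map_one, zpow_natCast]
  rcases Nat.even_or_odd (k * (k + 1) / 2) with h | h <;> simp [h.neg_one_pow]

theorem isLiftWithPhase_alphaMinus :
    M.IsLiftWithPhase M.alphaMinus ((k * (k + 1) / 2 : ℕ) + 1) := by
  refine M.isLiftWithPhase_of_eq_smul ?_
  change M.cliffordRep (-1 * ((-1) ^ (k * (k + 1) / 2) * M.alpha)) = _
  rw [map_mul, map_mul, map_pow, map_neg, map_one, ← Nat.cast_succ, zpow_natCast, pow_succ]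
  rcases Nat.even_or_odd (k * (k + 1) / 2) with h | h <;> simp [h.neg_one_pow]

/-- With `n = 2k + 1`, raising to the power `2n` turns each phase into `2 π (weight s + q n)`, a
multiple of `2 π`. This makes `2 aₙ` a period of every spinor. -/
theorem IsLiftWithPhase.pow_eq_one {M : CHDManifold k V} {y : Spin V} {q : ℤ}
    (h : M.IsLiftWithPhase y q) : M.cliffordRep (y : Cl V) ^ (2 * (2 * k + 1)) = 1 := by
  have hp : ∀ m : ℕ, M.cliffordRep (y : Cl V) ^ m * eigenMatrix k = eigenMatrix k *
      Matrix.diagonal fun s =>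
        Complex.exp (Complex.I * ((Real.pi * (weight s / (2 * k + 1) + q) : ℝ) : ℂ)) ^ m := by
    intro m
    induction m with
    | zero => simp
    | succ m ih =>
      rw [pow_succ, mul_assoc, h, ← mul_assoc, ih, mul_assoc, Matrix.diagonal_mul_diagonal]
      simp only [pow_succ]
  have h1 : ∀ s : Fin k → Fin 2, Complex.exp (Complex.I *
      ((Real.pi * (weight s / (2 * k + 1) + q) : ℝ) : ℂ)) ^ (2 * (2 * k + 1)) = 1 := by
    intro s
    rw [← Complex.exp_nat_mul, Complex.exp_eq_one_iff]
    refine ⟨weight s + q * (2 * k + 1), ?_⟩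
    have : (2 * (k : ℂ) + 1) ≠ 0 := by exact_mod_cast Nat.succ_ne_zero (2 * k)
    push_cast
    field_simp
  have h2 := hp (2 * (2 * k + 1))
  simp only [h1, Matrix.diagonal_one, mul_one] at h2
  calc _ = M.cliffordRep (y : Cl V) ^ (2 * (2 * k + 1)) * (eigenMatrix k * eigenMatrixInv k) := by
        rw [eigenMatrix_mul_inv, mul_one]
    _ = 1 := by rw [← mul_assoc, h2, eigenMatrix_mul_inv]

/-- On the spin group the reverse is the inverse, so the covering relation is an intertwining
relation. -/
theorem cliffordRep_mul_cliffordMul {y : Spin V} {B : V ≃ₗᵢ[ℝ] V} (hy : Covers y B) (v : V) :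
    M.cliffordRep (y : Cl V) * M.cliffordMul v = M.cliffordMul (B v) * M.cliffordRep (y : Cl V) := by
  rw [← cliffordRep_vec, ← cliffordRep_vec, ← map_mul, ← map_mul, ← hy v, mul_assoc _ _ (y : Cl V),
    reverse_mul_of_mem_spin y.2, mul_one]

/-! ### The holonomy generator has order dividing `n` -/

theorem A_pow_e (j : Fin k) (m : ℕ) :
    (M.A ^ m) (M.e ⟨2 * j.val, by omega⟩) =
      Real.cos (m * (2 * Real.pi * (j.val + 1) / (2 * k + 1))) • M.e ⟨2 * j.val, by omega⟩ +
      Real.sin (m * (2 * Real.pi * (j.val + 1) / (2 * k + 1))) • M.e ⟨2 * j.val + 1, by omega⟩ ∧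
    (M.A ^ m) (M.e ⟨2 * j.val + 1, by omega⟩) =
      -Real.sin (m * (2 * Real.pi * (j.val + 1) / (2 * k + 1))) • M.e ⟨2 * j.val, by omega⟩ +
      Real.cos (m * (2 * Real.pi * (j.val + 1) / (2 * k + 1))) • M.e ⟨2 * j.val + 1, by omega⟩ := by
  induction m with
  | zero => simp
  | succ m ih =>
    have h : ∀ v, (M.A ^ (m + 1)) v = M.A ((M.A ^ m) v) := fun v => by rw [pow_succ']; rfl
    rw [h, h, ih.1, ih.2]
    simp only [map_add, map_smul, A_e_even, A_e_odd]
    push_cast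
    simp only [add_mul (m : ℝ), one_mul, Real.cos_add, Real.sin_add]
    constructor <;> module

/-- Each plane rotates by a multiple of `2 π / n`, and the last basis vector is fixed. -/
theorem A_pow_eq_one : M.A ^ (2 * k + 1) = 1 := by
  have h : ∀ i, (M.A ^ (2 * k + 1)) (M.e i) = M.e i := by
    intro i
    by_cases hi : i.val < 2 * k
    · have hn : (2 * (k : ℝ) + 1) ≠ 0 := by positivity
      have hj := M.A_pow_e ⟨i.val / 2, by omega⟩ (2 * k + 1)
      have harg : ((2 * k + 1 : ℕ) : ℝ) * (2 * Real.pi * ((i.val / 2 : ℕ) + 1) / (2 * k + 1)) =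
          ((i.val / 2 + 1 : ℕ) : ℝ) * (2 * Real.pi) := by
        push_cast; field_simp
      simp only [harg, Real.cos_nat_mul_two_pi] at hj
      have hs : Real.sin (((i.val / 2 + 1 : ℕ) : ℝ) * (2 * Real.pi)) = 0 := by
        rw [show ((i.val / 2 + 1 : ℕ) : ℝ) * (2 * Real.pi) =
          ((2 * (i.val / 2 + 1) : ℕ) : ℝ) * Real.pi by push_cast; ring, Real.sin_nat_mul_pi]
      simp only [hs, one_smul, zero_smul, neg_zero, add_zero, zero_add] at hj
      rcases Nat.even_or_odd' i.val with ⟨c, hc | hc⟩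
      · have : i = ⟨2 * (i.val / 2), by omega⟩ := Fin.ext (by simp only; omega)
        rw [this]; exact hj.1
      · have : i = ⟨2 * (i.val / 2) + 1, by omega⟩ := Fin.ext (by simp only; omega)
        rw [this]; exact hj.2
    · have : i = Fin.last (2 * k) := Fin.ext (by simp only [Fin.val_last]; omega)
      have hf : M.A (M.e (Fin.last (2 * k))) = M.e (Fin.last (2 * k)) := by
        rw [M.e_last, M.A_a_last]
      have hm : ∀ m : ℕ, (M.A ^ m) (M.e (Fin.last (2 * k))) = M.e (Fin.last (2 * k)) := by
        intro m
        induction m with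
        | zero => rfl
        | succ m ih => rw [pow_succ]; exact (congrArg (M.A ^ m) hf).trans ih
      rw [this]
      exact hm _
  ext v
  have h2 := M.e.toBasis.ext (f₁ := ((M.A ^ (2 * k + 1)).toLinearEquiv : V →ₗ[ℝ] V))
    (f₂ := LinearMap.id) (fun i => by simpa using h i)
  exact LinearMap.congr_fun h2 v

end CHDManifold
end FlatCHD
end

noncomputable section

namespace FlatCHD

set_option linter.unusedSectionVars false

variable {k : ℕ} {V : Type*} [NormedAddCommGroup V] [InnerProductSpace ℝ V]

/-! ### Frequencies of periodic functions -/

section Frequencies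

variable {ι : Type*} [Fintype ι] [DecidableEq ι]

theorem innerₗ_nondegenerate : (innerₗ V).Nondegenerate := by
  constructor <;> intro x hx <;> have h := hx x <;>
    rwa [innerₗ_apply_apply, inner_self_eq_zero] at h

/-- The basis dual to `b`, scaled by `2 π`. -/
def freqBasis (b : Module.Basis ι ℝ V) : Module.Basis ι ℝ V :=
  LinearMap.BilinForm.dualBasis (innerₗ V) innerₗ_nondegenerate
    (b.unitsSMul fun _ => (Units.mk0 (2 * Real.pi) (by positivity))⁻¹)

theorem freqBasis_repr (b : Module.Basis ι ℝ V) (ξ : V) (i : ι) :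
    (freqBasis b).repr ξ i = ⟪ξ, b i⟫_ℝ / (2 * Real.pi) := by
  rw [freqBasis, LinearMap.BilinForm.dualBasis_repr_apply, Module.Basis.unitsSMul_apply,
    innerₗ_apply_apply, Units.smul_def, inner_smul_right]
  simp only [Units.val_inv_eq_inv_val, Units.val_mk0]
  ring

/-- The lattice of frequencies. -/
def freqLattice (b : Module.Basis ι ℝ V) : Submodule ℤ V :=
  Submodule.span ℤ (Set.range (freqBasis b))

theorem mem_freqLattice {b : Module.Basis ι ℝ V} {ξ : V} :
    ξ ∈ freqLattice b ↔ ∀ i, ∃ z : ℤ, ⟪ξ, b i⟫_ℝ = 2 * Real.pi * z := by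
  rw [freqLattice, Module.Basis.mem_span_iff_repr_mem]
  refine forall_congr' fun i => ?_
  rw [freqBasis_repr, Set.mem_range]
  refine exists_congr fun z => ?_
  have : (2 * Real.pi) ≠ 0 := by positivity
  rw [eq_comm, div_eq_iff this, mul_comm (2 * Real.pi)]
  rfl

/-- The frequency with prescribed integral coordinates. -/
def freq (b : Module.Basis ι ℝ V) (m : ι → ℤ) : V := ∑ i, (m i : ℝ) • freqBasis b i

theorem freq_injective (b : Module.Basis ι ℝ V) : Function.Injective (freq b) := by
  intro m m' h
  funext i
  have h1 : ∀ m : ι → ℤ, (freqBasis b).repr (freq b m) i = m i := fun m => by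
    rw [freq, Module.Basis.repr_sum_self]
  exact_mod_cast (h1 m).symm.trans ((congrArg (fun v => (freqBasis b).repr v i) h).trans (h1 m'))

theorem inner_freq (b : Module.Basis ι ℝ V) (m : ι → ℤ) (x : V) :
    ⟪freq b m, x⟫_ℝ = 2 * Real.pi * ∑ i, (m i : ℝ) * b.repr x i := by
  have h : ∀ i, ⟪freq b m, b i⟫_ℝ = 2 * Real.pi * m i := fun i => by
    have h1 : (freqBasis b).repr (freq b m) i = m i := by
      rw [freq, Module.Basis.repr_sum_self]
    rw [freqBasis_repr, div_eq_iff (by positivity)] at h1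
    rw [h1, mul_comm]
  conv_lhs => rw [← b.sum_repr x]
  rw [inner_sum, Finset.mul_sum]
  refine Finset.sum_congr rfl fun i _ => ?_
  rw [inner_smul_right, h]
  ring

theorem freq_mem (b : Module.Basis ι ℝ V) (m : ι → ℤ) : freq b m ∈ freqLattice b :=
  Submodule.sum_mem _ fun i _ => by
    rw [Int.cast_smul_eq_zsmul]
    exact Submodule.smul_mem _ _ (Submodule.subset_span ⟨i, rfl⟩)

theorem finite_freqLattice_norm_le (b : Module.Basis ι ℝ V) (r : ℝ) :
    {ξ : V | ξ ∈ freqLattice b ∧ ‖ξ‖ ≤ r}.Finite := by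
  have := (freqBasis b).finiteDimensional_of_finite
  have : ProperSpace V := FiniteDimensional.proper_real V
  refine (ZSpan.setFinite_inter (freqBasis b) (Metric.isBounded_closedBall (x := (0 : V))
    (r := r))).subset ?_
  rintro ξ ⟨h1, h2⟩
  exact ⟨by simpa using h2, h1⟩

theorem exists_summable_freqLattice (b : Module.Basis ι ℝ V) :
    ∃ R : ℝ, ∀ r : ℝ, R < r → Summable fun ξ : freqLattice b => ‖(ξ : V)‖ ^ (-r) := by
  have := (freqBasis b).finiteDimensional_of_finite
  have : DiscreteTopology (freqLattice b) :=
    inferInstanceAs (DiscreteTopology (Submodule.span ℤ (Set.range (freqBasis b))))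
  exact ⟨Module.finrank ℤ (freqLattice b), fun r hr =>
    ZLattice.summable_norm_rpow (freqLattice b) (-r) (by linarith)⟩

end Frequencies

/-! ### Trigonometric polynomials with values in the spinor module -/

/-- The character with frequency `ξ`. -/
def charFun (ξ x : V) : ℂ := Complex.exp (Complex.I * (⟪ξ, x⟫_ℝ : ℂ))

theorem charFun_add (ξ x y : V) : charFun ξ (x + y) = charFun ξ x * charFun ξ y := by
  rw [charFun, charFun, charFun, ← Complex.exp_add, inner_add_right]
  push_cast; ring_nf

theorem contDiff_charFun (ξ : V) : ContDiff ℝ ∞ (charFun ξ) := by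
  have h : ContDiff ℝ ∞ fun x : V => ((⟪ξ, x⟫_ℝ : ℝ) : ℂ) :=
    Complex.ofRealCLM.contDiff.comp (contDiff_const.inner ℝ contDiff_id)
  exact (contDiff_const.mul h).cexp

theorem hasFDerivAt_charFun (ξ x : V) :
    HasFDerivAt (charFun ξ) (charFun ξ x • Complex.I • (Complex.ofRealCLM ∘L innerSL ℝ ξ)) x := by
  have h : HasFDerivAt (fun x : V => ((⟪ξ, x⟫_ℝ : ℝ) : ℂ)) (Complex.ofRealCLM ∘L innerSL ℝ ξ) x :=
    (Complex.ofRealCLM ∘L innerSL ℝ ξ).hasFDerivAt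
  exact (h.const_mul Complex.I).cexp

/-- The character with frequency `ξ` as a monoid homomorphism. -/
def charHom (ξ : V) : Multiplicative V →* ℂ where
  toFun x := charFun ξ x.toAdd
  map_one' := by simp [charFun]
  map_mul' x y := by rw [toAdd_mul, charFun_add]

/-- For distinct frequencies, a suitable multiple of their difference is a point at which the phases
differ by exactly `π`. -/
theorem charHom_injective : Function.Injective (charHom : V → Multiplicative V →* ℂ) := by
  intro ξ η h
  by_contra hne
  have hn : ⟪ξ - η, ξ - η⟫_ℝ ≠ 0 := fun h0 => hne (sub_eq_zero.mp (inner_self_eq_zero.mp h0))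
  set x : V := (Real.pi / ⟪ξ - η, ξ - η⟫_ℝ) • (ξ - η) with hx
  have h1 : charFun ξ x = charFun η x := DFunLike.congr_fun h (Multiplicative.ofAdd x)
  have h2 : ⟪ξ, x⟫_ℝ = ⟪η, x⟫_ℝ + Real.pi := by
    rw [← sub_eq_iff_eq_add', ← inner_sub_left, hx, inner_smul_right, div_mul_cancel₀ _ hn]
  have h3 : charFun ξ x = -charFun η x := by
    rw [charFun, charFun, h2]
    push_cast
    rw [mul_add, Complex.exp_add, mul_comm Complex.I (Real.pi : ℂ), Complex.exp_pi_mul_I]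
    ring
  rw [h1] at h3
  exact Complex.exp_ne_zero _ (self_eq_neg.mp h3)

/-- The trigonometric polynomial with prescribed coefficients. -/
def trigPoly : (V →₀ Spinor k) →ₗ[ℂ] (V → Spinor k) :=
  Finsupp.lsum ℂ fun ξ => LinearMap.pi fun x => charFun ξ x • LinearMap.id

theorem trigPoly_single (ξ : V) (u : Spinor k) (x : V) :
    trigPoly (Finsupp.single ξ u) x = charFun ξ x • u := by
  simp [trigPoly]

theorem trigPoly_apply (c : V →₀ Spinor k) (x : V) :
    trigPoly c x = c.sum fun ξ u => charFun ξ x • u := by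
  simp only [trigPoly, Finsupp.lsum_apply, Finsupp.sum, Finset.sum_apply]
  rfl

/-- Dedekind's independence of characters, applied to each spinor component. It allows identities
between trigonometric polynomials to be read off coefficient by coefficient. -/
theorem trigPoly_injective : Function.Injective (trigPoly (k := k) (V := V)) := by
  rw [← LinearMap.ker_eq_bot, LinearMap.ker_eq_bot']
  intro c hc
  have hli : LinearIndependent ℂ fun ξ : V => (charHom ξ : Multiplicative V → ℂ) :=
    (linearIndependent_monoidHom (Multiplicative V) ℂ).comp _ charHom_injective
  rw [linearIndependent_iff'] at hli
  ext ξ s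
  by_cases hξ : ξ ∈ c.support
  · refine hli c.support (fun ξ => c ξ s) ?_ ξ hξ
    funext x
    have h := congrFun (congrFun hc x.toAdd) s
    rw [trigPoly_apply, Finsupp.sum, Finset.sum_apply] at h
    rw [Finset.sum_apply]
    refine Eq.trans (Finset.sum_congr rfl fun η _ => ?_) h
    simp only [Pi.smul_apply, smul_eq_mul]
    exact mul_comm _ _
  · rw [Finsupp.notMem_support_iff.mp hξ]; rfl

/-- Multiplication of the coefficients by matrices depending on the frequency. -/
def twist (B : V → SpinorMatrix k) : (V →₀ Spinor k) →ₗ[ℂ] (V →₀ Spinor k) :=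
  Finsupp.lsum ℂ fun ξ => Finsupp.lsingle ξ ∘ₗ (B ξ).mulVecLin

theorem twist_single (B : V → SpinorMatrix k) (ξ : V) (u : Spinor k) :
    twist B (Finsupp.single ξ u) = Finsupp.single ξ (B ξ *ᵥ u) := by
  simp [twist]

theorem twist_apply (B : V → SpinorMatrix k) (c : V →₀ Spinor k) (ξ : V) :
    twist B c ξ = B ξ *ᵥ c ξ := by
  classical
  induction c using Finsupp.induction_linear with
  | zero => simp
  | add f g hf hg => simp only [map_add, Finsupp.add_apply, hf, hg, Matrix.mulVec_add]
  | single η u =>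
    rw [twist_single, Finsupp.single_apply, Finsupp.single_apply]
    split_ifs with h
    · rw [h]
    · simp

theorem trigPoly_add_right (c : V →₀ Spinor k) (x v : V) :
    trigPoly c (x + v) = trigPoly (twist (fun ξ => charFun ξ v • (1 : SpinorMatrix k)) c) x := by
  induction c using Finsupp.induction_linear with
  | zero => simp
  | add f g hf hg => simp only [map_add, Pi.add_apply, hf, hg]
  | single η u =>
    rw [twist_single, trigPoly_single, trigPoly_single, Matrix.smul_mulVec, Matrix.one_mulVec,
      smul_smul, charFun_add]

theorem mulVec_trigPoly (B : SpinorMatrix k) (c : V →₀ Spinor k) (x : V) :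
    B *ᵥ trigPoly c x = trigPoly (twist (fun _ => B) c) x := by
  induction c using Finsupp.induction_linear with
  | zero => simp
  | add f g hf hg => simp only [map_add, Pi.add_apply, ← hf, ← hg, Matrix.mulVec_add]
  | single η u => rw [twist_single, trigPoly_single, trigPoly_single, Matrix.mulVec_smul]

theorem trigPoly_isometry (B : V ≃ₗᵢ[ℝ] V) (c : V →₀ Spinor k) (x : V) :
    trigPoly c (B x) = trigPoly (Finsupp.equivMapDomain B.symm.toEquiv c) x := by
  induction c using Finsupp.induction_linear with
  | zero => simp
  | add f g hf hg =>
    have h : Finsupp.equivMapDomain B.symm.toEquiv (f + g) =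
        Finsupp.equivMapDomain B.symm.toEquiv f + Finsupp.equivMapDomain B.symm.toEquiv g := by
      ext; simp
    rw [h, map_add, map_add, Pi.add_apply, Pi.add_apply, hf, hg]
  | single η u =>
    rw [Finsupp.equivMapDomain_single, trigPoly_single, trigPoly_single, charFun, charFun]
    congr 4
    rw [← B.symm.inner_map_map η (B x), B.symm_apply_apply]
    rfl

theorem contDiff_trigPoly (c : V →₀ Spinor k) : ContDiff ℝ ∞ (trigPoly c) := by
  induction c using Finsupp.induction_linear with
  | zero => rw [map_zero]; exact contDiff_const
  | add f g hf hg => rw [map_add]; exact hf.add hg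
  | single η u =>
    have : trigPoly (Finsupp.single η u) = fun x => charFun η x • u :=
      funext fun x => trigPoly_single η u x
    rw [this]
    exact (contDiff_charFun η).smul contDiff_const

namespace CHDManifold

variable (M : CHDManifold k V)

/-- Differentiating a character along `e j` multiplies it by `i ⟪ξ, e j⟫`, and summing over the
orthonormal basis reassembles Clifford multiplication by `ξ`. -/
theorem dirac_trigPoly (c : V →₀ Spinor k) (x : V) : M.dirac (trigPoly c) x =
    trigPoly (twist (fun ξ => Complex.I • M.cliffordMul ξ) c) x := by
  induction c using Finsupp.induction_linear with
  | zero =>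
    have : (0 : V → Spinor k) = fun _ => 0 := rfl
    simp [dirac, this]
  | add f g hf hg =>
    have h1 := ((contDiff_trigPoly f).differentiable (by simp)) x
    have h2 := ((contDiff_trigPoly g).differentiable (by simp)) x
    rw [map_add, map_add, map_add, Pi.add_apply, ← hf, ← hg]
    simp only [dirac]
    rw [fderiv_add h1 h2]
    simp only [add_apply, Matrix.mulVec_add, Finset.sum_add_distrib]
  | single η u =>
    have h : trigPoly (Finsupp.single η u) = fun x => charFun η x • u :=
      funext fun x => trigPoly_single η u x
    rw [twist_single, trigPoly_single, h]
    simp only [dirac]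
    have hd : HasFDerivAt (fun x => charFun η x • u)
        ((charFun η x • Complex.I • (Complex.ofRealCLM ∘L innerSL ℝ η)).smulRight u) x :=
      (hasFDerivAt_charFun η x).smul_const u
    rw [hd.fderiv, cliffordMul_apply, Finset.smul_sum, Matrix.sum_mulVec, Finset.smul_sum]
    refine Finset.sum_congr rfl fun j _ => ?_
    rw [cliffordRep_vec, cliffordMul_e]
    simp only [ContinuousLinearMap.smulRight_apply, smul_apply,
      ContinuousLinearMap.comp_apply, innerSL_apply_apply, Complex.ofRealCLM_apply, smul_eq_mul]
    rw [Matrix.mulVec_smul, Matrix.smul_mulVec, mul_smul, mul_smul, real_inner_comm]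
    congr 2
    ext s
    simp [Matrix.smul_mulVec]

end CHDManifold
end FlatCHD
end

noncomputable section

namespace FlatCHD
namespace CHDManifold

variable {k : ℕ} {V : Type*} [NormedAddCommGroup V] [InnerProductSpace ℝ V]
variable (M : CHDManifold k V)

/-! ### Spinors for the spin structure of a lift -/

theorem g_apply (x : V) :
    M.g x = M.A x + (1 / (2 * k + 1) : ℝ) • M.a (Fin.last (2 * k)) := by
  simp [g, add_comm]

/-- Equivariance passes to products and inverses in the deck group because the lift is a
homomorphism, so it need only be tested on generators. -/
theorem mem_spinors_iff {y : Spin V} (hy : Covers y M.A) {ψ : V → Spinor k} :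
    ψ ∈ M.spinors (M.spinStructureOfLift y hy) ↔ ContDiff ℝ ∞ ψ ∧
      (∀ (i : Fin (2 * k)) (x : V), ψ (x + M.a i.castSucc) = ψ x) ∧
      ∀ x, ψ (M.g x) = M.cliffordRep (y : Cl V) *ᵥ ψ x := by
  have hg : M.g ∈ M.deck := Subgroup.subset_closure (Set.mem_insert _ _)
  have ht : ∀ i : Fin (2 * k), translation (M.a i.castSucc) ∈ M.deck := fun i =>
    Subgroup.subset_closure (Set.mem_insert_of_mem _ ⟨i, rfl⟩)
  have htr : ∀ (i : Fin (2 * k)) (x : V),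
      translation (M.a i.castSucc) x = x + M.a i.castSucc := fun i x => by
    simp [translation, add_comm]
  constructor
  · rintro ⟨h1, h2⟩
    refine ⟨h1, fun i x => ?_, fun x => ?_⟩
    · have h := h2 ⟨_, ht i⟩ x
      rw [spinStructureOfLift_translation] at h
      simpa [htr] using h
    · have h := h2 ⟨_, hg⟩ x
      rwa [spinStructureOfLift_g] at h
  · rintro ⟨h1, h2, h3⟩
    refine ⟨h1, ?_⟩
    rintro ⟨γ, hγ⟩
    induction hγ using Subgroup.closure_induction with
    | mem γ hγ =>
      rcases hγ with rfl | ⟨i, rfl⟩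
      · intro x
        change ψ (M.g x) =
          M.cliffordRep ((M.spinStructureOfLift y hy).lift ⟨M.g, hg⟩ : Cl V) *ᵥ ψ x
        rw [spinStructureOfLift_g]
        exact h3 x
      · intro x
        change ψ (translation (M.a i.castSucc) x) =
          M.cliffordRep ((M.spinStructureOfLift y hy).lift ⟨_, ht i⟩ : Cl V) *ᵥ ψ x
        rw [spinStructureOfLift_translation, htr, h2]
        simp
    | one =>
      intro x
      have h : (⟨1, one_mem _⟩ : M.deck) = 1 := rfl
      rw [h, map_one]
      simp
    | mul γ γ' hγ hγ' ih ih' =>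
      intro x
      have h : (⟨γ * γ', mul_mem hγ hγ'⟩ : M.deck) = ⟨γ, hγ⟩ * ⟨γ', hγ'⟩ := rfl
      rw [h, map_mul]
      change ψ (γ (γ' x)) = _
      rw [ih (γ' x), ih' x, Matrix.mulVec_mulVec]
      congr 1
      exact (map_mul _ _ _).symm
    | inv γ hγ ih =>
      intro x
      have h : (⟨γ⁻¹, inv_mem hγ⟩ : M.deck) = (⟨γ, hγ⟩)⁻¹ := rfl
      have h4 := ih (γ⁻¹ x)
      have h5 : γ (γ⁻¹ x) = x := γ.apply_symm_apply x
      change ψ (γ (γ⁻¹ x)) = _ at h4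
      rw [h5] at h4
      rw [h4, Matrix.mulVec_mulVec]
      change ψ (γ⁻¹ x) = _
      have h6 : M.cliffordRep ((M.spinStructureOfLift y hy).lift ⟨γ⁻¹, inv_mem hγ⟩ : Cl V) *
          M.cliffordRep ((M.spinStructureOfLift y hy).lift ⟨γ, hγ⟩ : Cl V) = 1 := by
        rw [h, map_inv, ← map_mul, ← map_one M.cliffordRep]
        congr 1
        exact congrArg Subtype.val (inv_mul_cancel ((M.spinStructureOfLift y hy).lift ⟨γ, hγ⟩))
      exact (congrArg (· *ᵥ ψ (γ⁻¹ x)) h6).symm ▸ (Matrix.one_mulVec _).symm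

/-! ### The spaces of coefficients of eigenspinors -/

/-- The coefficient functions whose trigonometric polynomials are eigenspinors. -/
def coeffSpace (R : SpinorMatrix k) (l : ℝ) : Submodule ℂ (V →₀ Spinor k) where
  carrier := {c | (∀ ξ, (Complex.I • M.cliffordMul ξ) *ᵥ c ξ = (l : ℂ) • c ξ) ∧
    (∀ (i : Fin (2 * k)) (ξ : V), charFun ξ (M.a i.castSucc) • c ξ = c ξ) ∧
    ∀ ξ, charFun ξ ((1 / (2 * k + 1) : ℝ) • M.a (Fin.last (2 * k))) • c (M.A ξ) = R *ᵥ c ξ}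
  zero_mem' := ⟨by simp, by simp, by simp⟩
  add_mem' := fun {c d} hc hd => ⟨fun ξ => by
      rw [Finsupp.add_apply, Matrix.mulVec_add, hc.1, hd.1, smul_add],
    fun i ξ => by rw [Finsupp.add_apply, smul_add, hc.2.1, hd.2.1],
    fun ξ => by simp only [Finsupp.add_apply, smul_add, hc.2.2, hd.2.2, Matrix.mulVec_add]⟩
  smul_mem' := fun z c hc => ⟨fun ξ => by
      rw [Finsupp.smul_apply, Matrix.mulVec_smul, hc.1, smul_comm],
    fun i ξ => by rw [Finsupp.smul_apply, smul_comm, hc.2.1],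
    fun ξ => by simp only [Finsupp.smul_apply, smul_comm _ z, hc.2.2, Matrix.mulVec_smul]⟩

theorem trigPoly_g (c : V →₀ Spinor k) (x : V) : trigPoly c (M.g x) =
    trigPoly (Finsupp.equivMapDomain M.A.symm.toEquiv (twist (fun ξ =>
      charFun ξ ((1 / (2 * k + 1) : ℝ) • M.a (Fin.last (2 * k))) • (1 : SpinorMatrix k)) c)) x := by
  rw [g_apply, trigPoly_add_right, trigPoly_isometry]

/-- `A` is an isometry fixing `aₙ`. This lets the phase in `coeffSpace` be written at `ξ` instead of
`A ξ`. -/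
theorem charFun_A_last (ξ : V) (t : ℝ) : charFun (M.A ξ) (t • M.a (Fin.last (2 * k))) =
    charFun ξ (t • M.a (Fin.last (2 * k))) := by
  have h : M.A (t • M.a (Fin.last (2 * k))) = t • M.a (Fin.last (2 * k)) := by
    rw [map_smul, A_a_last]
  rw [charFun, charFun]
  conv_lhs => rw [← h, LinearIsometryEquiv.inner_map_map]

theorem trigPoly_mem_eigenspace_iff {y : Spin V} (hy : Covers y M.A) (l : ℝ)
    (c : V →₀ Spinor k) : trigPoly c ∈ M.eigenspace (M.spinStructureOfLift y hy) l ↔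
      c ∈ M.coeffSpace (M.cliffordRep (y : Cl V)) l := by
  have hfun : ∀ c d : V →₀ Spinor k, (∀ x, trigPoly c x = trigPoly d x) ↔ ∀ ξ, c ξ = d ξ := by
    intro c d
    rw [← funext_iff, trigPoly_injective.eq_iff, Finsupp.ext_iff]
  have h1 : (∀ x, M.dirac (trigPoly c) x = (l : ℂ) • trigPoly c x) ↔
      ∀ ξ, (Complex.I • M.cliffordMul ξ) *ᵥ c ξ = (l : ℂ) • c ξ := by
    have := hfun (twist (fun ξ => Complex.I • M.cliffordMul ξ) c) ((l : ℂ) • c)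
    simp only [twist_apply, map_smul, Finsupp.smul_apply, Pi.smul_apply] at this
    rw [← this]
    simp only [dirac_trigPoly]
  have h2 : ∀ i : Fin (2 * k), (∀ x, trigPoly c (x + M.a i.castSucc) = trigPoly c x) ↔
      ∀ ξ, charFun ξ (M.a i.castSucc) • c ξ = c ξ := by
    intro i
    simp only [trigPoly_add_right, hfun, twist_apply, Matrix.smul_mulVec, Matrix.one_mulVec]
  have h3 : (∀ x, trigPoly c (M.g x) = M.cliffordRep (y : Cl V) *ᵥ trigPoly c x) ↔
      ∀ ξ, charFun ξ ((1 / (2 * k + 1) : ℝ) • M.a (Fin.last (2 * k))) • c (M.A ξ) =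
        M.cliffordRep (y : Cl V) *ᵥ c ξ := by
    simp only [trigPoly_g, mulVec_trigPoly, hfun, twist_apply, Finsupp.equivMapDomain_apply,
      Matrix.smul_mulVec, Matrix.one_mulVec]
    refine forall_congr' fun ξ => ?_
    change charFun (M.A ξ) _ • c (M.A ξ) = _ ↔ _
    rw [charFun_A_last]
  change trigPoly c ∈ M.spinors _ ∧ _ ↔ _
  rw [mem_spinors_iff, h1, h3]
  constructor
  · rintro ⟨⟨-, h4, h5⟩, h6⟩
    exact ⟨h6, fun i => (h2 i).1 (h4 i), h5⟩
  · rintro ⟨h4, h5, h6⟩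
    exact ⟨⟨contDiff_trigPoly c, fun i => (h2 i).2 (h5 i), h6⟩, h4⟩

/-! ### Eigenspinors are trigonometric polynomials -/

/-- The basis `a₁, …, aₙ₋₁, 2 aₙ` of a lattice of periods. -/
def periodBasis : Module.Basis (Fin (2 * k + 1)) ℝ V :=
  M.a.unitsSMul fun i => if i = Fin.last (2 * k) then Units.mk0 2 two_ne_zero else 1

theorem periodBasis_castSucc (i : Fin (2 * k)) : M.periodBasis i.castSucc = M.a i.castSucc := by
  rw [periodBasis, Module.Basis.unitsSMul_apply, if_neg (Fin.castSucc_lt_last i).ne, one_smul]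

theorem periodBasis_last :
    M.periodBasis (Fin.last (2 * k)) = (2 : ℝ) • M.a (Fin.last (2 * k)) := by
  rw [periodBasis, Module.Basis.unitsSMul_apply, if_pos rfl]
  rfl

theorem g_iterate (m : ℕ) (x : V) : M.g^[m] x =
    (M.A ^ m) x + ((m : ℝ) / (2 * k + 1)) • M.a (Fin.last (2 * k)) := by
  induction m with
  | zero => simp
  | succ m ih =>
    rw [Function.iterate_succ_apply', ih, g_apply, map_add, map_smul, A_a_last, pow_succ']
    push_cast
    rw [add_div, add_smul, add_assoc]
    rfl

/-- For the last period, `g` iterated `2n` times is translation by `2 aₙ`, since `A ^ n = 1`; the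
matching power of the lift acts trivially. One factor `n` would not do for both lifts, which is why
the period is `2 aₙ`. -/
theorem isPeriodic_of_mem_spinors {y : Spin V} {hy : Covers y M.A} {q : ℤ}
    (hq : M.IsLiftWithPhase y q) {ψ : V → Spinor k}
    (hψ : ψ ∈ M.spinors (M.spinStructureOfLift y hy)) : IsPeriodic M.periodBasis ψ := by
  obtain ⟨-, h1, h2⟩ := (M.mem_spinors_iff hy).1 hψ
  intro i x
  induction i using Fin.lastCases with
  | cast i => rw [periodBasis_castSucc, h1]
  | last =>
    have h3 : ∀ (m : ℕ) (x : V), ψ (M.g^[m] x) = (M.cliffordRep (y : Cl V)) ^ m *ᵥ ψ x := by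
      intro m
      induction m with
      | zero => simp
      | succ m ih =>
        intro x
        rw [Function.iterate_succ_apply', h2, ih, Matrix.mulVec_mulVec, pow_succ']
    have h4 := h3 (2 * (2 * k + 1)) x
    rw [hq.pow_eq_one, Matrix.one_mulVec, g_iterate, mul_comm 2, pow_mul, A_pow_eq_one, one_pow] at h4
    rw [periodBasis_last, ← h4]
    congr 2
    have : (2 * (k : ℝ) + 1) ≠ 0 := by positivity
    push_cast
    rw [mul_div_right_comm, div_self this, one_mul]

/-- The symbol squares to `‖ξ‖ ^ 2`. -/
theorem norm_eq_abs_of_cliffordMul_eigenvector {ξ : V} {u : Spinor k} {l : ℝ}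
    (h : (Complex.I • M.cliffordMul ξ) *ᵥ u = (l : ℂ) • u) (hu : u ≠ 0) : ‖ξ‖ = |l| := by
  have h1 : (Complex.I • M.cliffordMul ξ) *ᵥ ((Complex.I • M.cliffordMul ξ) *ᵥ u) =
      ((l : ℂ) * l) • u := by
    rw [h, Matrix.mulVec_smul, h, smul_smul]
  rw [Matrix.mulVec_mulVec, smul_mul_smul_comm, cliffordMul_sq, cliffForm_apply,
    Algebra.algebraMap_eq_smul_one, Complex.I_mul_I, neg_smul, neg_smul, smul_neg, one_smul, neg_neg,
    Matrix.smul_mulVec, Matrix.one_mulVec] at h1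
  obtain ⟨s, hs⟩ := Function.ne_iff.mp hu
  have h2 := congrFun h1 s
  simp only [Pi.smul_apply, smul_eq_mul, Complex.real_smul] at h2
  have h3 : ⟪ξ, ξ⟫_ℝ = l * l := by exact_mod_cast mul_right_cancel₀ hs h2
  rw [real_inner_self_eq_norm_sq, ← sq] at h3
  rw [← abs_norm]
  exact (sq_eq_sq_iff_abs_eq_abs _ _).1 h3

/-- Taking Fourier coefficients turns the Dirac equation into an eigenvalue equation for the symbol
at each frequency. Nonzero coefficients then lie on a sphere, which meets the frequency lattice in a
finite set. -/
theorem eigenspace_le_range_trigPoly {y : Spin V} {hy : Covers y M.A} {q : ℤ}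
    (hq : M.IsLiftWithPhase y q) (l : ℝ) :
    M.eigenspace (M.spinStructureOfLift y hy) l ≤ LinearMap.range trigPoly := by
  rintro ψ ⟨hψ, hD⟩
  have hper := M.isPeriodic_of_mem_spinors hq hψ
  have hsm : ContDiff ℝ ∞ ψ := hψ.1
  set b := M.periodBasis with hb
  have hcd : Continuous (fderiv ℝ ψ) := hsm.continuous_fderiv (by simp)
  have hdper : IsPeriodic b (fderiv ℝ ψ) := fun i x => by
    rw [← fderiv_comp_add_right]
    congr 1
    exact funext fun z => hper i z
  have hp : ∀ s, IsPeriodic b fun x => ψ x s := fun s i x => congrFun (hper i x) s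
  have hc : ∀ s, Continuous fun x => ψ x s := fun s =>
    (continuous_apply s).comp hsm.continuous
  have hp' : ∀ (j : Fin (2 * k + 1)) s, IsPeriodic b fun x => fderiv ℝ ψ x (M.e j) s :=
    fun j s i x => by simp only [hdper i x]
  have hc' : ∀ (j : Fin (2 * k + 1)) s, Continuous fun x => fderiv ℝ ψ x (M.e j) s := fun j s =>
    (continuous_apply s).comp (hcd.clm_apply continuous_const)
  set C : (Fin (2 * k + 1) → ℤ) → Spinor k := fun m s => periodicCoeff b (fun x => ψ x s) m with hC
  have hcoef : ∀ m j s, periodicCoeff b (fun x => fderiv ℝ ψ x (M.e j) s) m =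
      Complex.I * (⟪freq b m, M.e j⟫_ℝ : ℂ) * C m s := by
    intro m j s
    rw [periodicCoeff_deriv (hp s) (hc s) (hp' j s) (hc' j s) (v := M.e j), inner_freq]
    · push_cast
      ring
    · intro x
      have h1 : HasFDerivAt ψ (fderiv ℝ ψ x) (x + (0 : ℝ) • M.e j) := by
        rw [zero_smul, add_zero]
        exact ((hsm.differentiable (by simp)) x).hasFDerivAt
      have h2 : HasDerivAt (fun t : ℝ => x + t • M.e j) (M.e j) 0 := by
        simpa using ((hasDerivAt_id (0 : ℝ)).smul_const (M.e j)).const_add x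
      exact hasDerivAt_pi.1 (h1.comp_hasDerivAt (0 : ℝ) h2) s
  have heig : ∀ m, (Complex.I • M.cliffordMul (freq b m)) *ᵥ C m = (l : ℂ) • C m := by
    intro m
    funext s
    -- Both sides are put in the shape of a finite linear combination, the right one over `Unit`, so
    -- that `periodicCoeff_sum` applies to each.
    have h1 : ∀ x, ∑ p : Fin (2 * k + 1) × (Fin k → Fin 2),
        gamma p.1 s p.2 * fderiv ℝ ψ x (M.e p.1) p.2 = ∑ _p : Unit, (l : ℂ) * ψ x s := by
      intro x
      have h := congrFun (hD x) s
      simp only [dirac, cliffordRep_vec, cliffordMul_e, Finset.sum_apply, Matrix.mulVec,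
        dotProduct, Pi.smul_apply, smul_eq_mul] at h
      rw [Fintype.sum_prod_type, h]
      simp
    have h2 := periodicCoeff_congr b h1 m
    rw [periodicCoeff_sum b _ _ (fun (p : Fin (2 * k + 1) × (Fin k → Fin 2)) x =>
        fderiv ℝ ψ x (M.e p.1) p.2) (fun p => hp' p.1 p.2) (fun p => hc' p.1 p.2),
      periodicCoeff_sum b _ (fun _ => (l : ℂ)) _ (fun _ => hp s) (fun _ => hc s)] at h2
    simp only [hcoef, Finset.univ_unique, Finset.sum_singleton] at h2
    rw [Pi.smul_apply, smul_eq_mul]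
    refine Eq.trans ?_ h2
    rw [Fintype.sum_prod_type, cliffordMul_apply, Finset.smul_sum, Matrix.sum_mulVec,
      Finset.sum_apply]
    refine Finset.sum_congr rfl fun j _ => ?_
    simp only [Matrix.mulVec, dotProduct, Matrix.smul_apply, Complex.real_smul, smul_eq_mul]
    refine Finset.sum_congr rfl fun t _ => ?_
    rw [real_inner_comm]
    ring
  have hfin : {m : Fin (2 * k + 1) → ℤ | C m ≠ 0}.Finite := by
    refine ((finite_freqLattice_norm_le b |l|).preimage
      (freq_injective b).injOn).subset fun m hm => ?_
    exact ⟨freq_mem b m, (M.norm_eq_abs_of_cliffordMul_eigenvector (heig m) hm).le⟩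
  refine ⟨∑ m ∈ hfin.toFinset, Finsupp.single (freq b m) (C m), ?_⟩
  funext x
  rw [map_sum, Finset.sum_apply]
  simp only [trigPoly_single]
  funext s
  rw [eq_sum_of_periodicCoeff_eq_zero (hp s) (hc s) hfin.toFinset _ x, Finset.sum_apply]
  · refine Finset.sum_congr rfl fun m _ => ?_
    rw [Pi.smul_apply, smul_eq_mul, charFun, inner_freq]
    congr 2
    push_cast
    ring
  · intro m hm
    have : C m = 0 := by simpa using hm
    exact congrFun this s

theorem eigenspace_eq_map {y : Spin V} {hy : Covers y M.A} {q : ℤ}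
    (hq : M.IsLiftWithPhase y q) (l : ℝ) : M.eigenspace (M.spinStructureOfLift y hy) l =
      (M.coeffSpace (M.cliffordRep (y : Cl V)) l).map trigPoly := by
  ext ψ
  rw [Submodule.mem_map]
  constructor
  · intro hψ
    obtain ⟨c, rfl⟩ := M.eigenspace_le_range_trigPoly hq l hψ
    exact ⟨c, (M.trigPoly_mem_eigenspace_iff hy l c).1 hψ, rfl⟩
  · rintro ⟨c, hc, rfl⟩
    exact (M.trigPoly_mem_eigenspace_iff hy l c).2 hc

/-- An eigenspace is isomorphic to the space of the coefficients of its elements. -/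
def coeffSpaceEquiv {y : Spin V} {hy : Covers y M.A} {q : ℤ}
    (hq : M.IsLiftWithPhase y q) (l : ℝ) : M.coeffSpace (M.cliffordRep (y : Cl V)) l ≃ₗ[ℂ]
      M.eigenspace (M.spinStructureOfLift y hy) l :=
  (Submodule.equivMapOfInjective _ trigPoly_injective _).trans
    (LinearEquiv.ofEq _ _ (M.eigenspace_eq_map hq l).symm)

/-- By uniqueness of coefficients, periodicity forces the character of any frequency that occurs to
be `1` on every period. -/
theorem mem_freqLattice_of_mem_coeffSpace {y : Spin V} {hy : Covers y M.A} {q : ℤ}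
    (hq : M.IsLiftWithPhase y q) {l : ℝ} {c : V →₀ Spinor k}
    (hc : c ∈ M.coeffSpace (M.cliffordRep (y : Cl V)) l) {ξ : V} (hξ : c ξ ≠ 0) :
    ξ ∈ freqLattice M.periodBasis := by
  have h1 := M.isPeriodic_of_mem_spinors hq ((M.trigPoly_mem_eigenspace_iff hy l c).2 hc).1
  rw [mem_freqLattice]
  intro i
  have h2 : trigPoly (twist (fun ξ => charFun ξ (M.periodBasis i) • (1 : SpinorMatrix k)) c) =
      trigPoly c := funext fun x => by rw [← trigPoly_add_right]; exact h1 i x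
  have h3 := DFunLike.congr_fun (trigPoly_injective h2) ξ
  rw [twist_apply, Matrix.smul_mulVec, Matrix.one_mulVec] at h3
  obtain ⟨s, hs⟩ := Function.ne_iff.mp hξ
  have h4 : charFun ξ (M.periodBasis i) = 1 :=
    mul_right_cancel₀ hs ((congrFun h3 s).trans (one_mul _).symm)
  rw [charFun, Complex.exp_eq_one_iff] at h4
  obtain ⟨z, hz⟩ := h4
  refine ⟨z, ?_⟩
  have h5 : (⟪ξ, M.periodBasis i⟫_ℝ : ℂ) = 2 * Real.pi * z :=
    mul_left_cancel₀ Complex.I_ne_zero (by rw [hz]; ring)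
  exact_mod_cast h5

/-- The frequencies which occur in the eigenspace for `l`. -/
def spectralFreqs (l : ℝ) : Set V := {ξ | ξ ∈ freqLattice M.periodBasis ∧ ‖ξ‖ = |l|}

theorem finite_spectralFreqs (l : ℝ) : (M.spectralFreqs l).Finite :=
  (finite_freqLattice_norm_le M.periodBasis |l|).subset fun _ h => ⟨h.1, h.2.le⟩

theorem coeffSpace_le_supported {y : Spin V} {hy : Covers y M.A} {q : ℤ}
    (hq : M.IsLiftWithPhase y q) (l : ℝ) : M.coeffSpace (M.cliffordRep (y : Cl V)) l ≤
      Finsupp.supported (Spinor k) ℂ (M.spectralFreqs l) := by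
  intro c hc
  rw [Finsupp.mem_supported]
  intro ξ hξ
  have hξ' : c ξ ≠ 0 := by simpa using hξ
  exact ⟨M.mem_freqLattice_of_mem_coeffSpace (hy := hy) hq hc hξ',
    M.norm_eq_abs_of_cliffordMul_eigenvector (hc.1 ξ) hξ'⟩

theorem finiteDimensional_supported (l : ℝ) :
    FiniteDimensional ℂ (Finsupp.supported (Spinor k) ℂ (M.spectralFreqs l)) := by
  have := (M.finite_spectralFreqs l).to_subtype
  exact Module.Finite.equiv (Finsupp.supportedEquivFinsupp (M := Spinor k) (R := ℂ)
    (M.spectralFreqs l)).symm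

theorem finiteDimensional_coeffSpace {y : Spin V} {hy : Covers y M.A} {q : ℤ}
    (hq : M.IsLiftWithPhase y q) (l : ℝ) :
    FiniteDimensional ℂ (M.coeffSpace (M.cliffordRep (y : Cl V)) l) := by
  have := M.finiteDimensional_supported l
  exact Submodule.finiteDimensional_of_le (M.coeffSpace_le_supported (hy := hy) hq l)

theorem finrank_eigenspace {y : Spin V} {hy : Covers y M.A} {q : ℤ}
    (hq : M.IsLiftWithPhase y q) (l : ℝ) :
    Module.finrank ℂ (M.eigenspace (M.spinStructureOfLift y hy) l) =
      Module.finrank ℂ (M.coeffSpace (M.cliffordRep (y : Cl V)) l) :=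
  (M.coeffSpaceEquiv hq l).finrank_eq.symm

/-- A crude bound, one spinor per frequency, which serves to prove absolute convergence of the eta
series. -/
theorem finrank_coeffSpace_le {y : Spin V} {hy : Covers y M.A} {q : ℤ}
    (hq : M.IsLiftWithPhase y q) (l : ℝ) :
    Module.finrank ℂ (M.coeffSpace (M.cliffordRep (y : Cl V)) l) ≤
      (M.spectralFreqs l).ncard * 2 ^ k := by
  have := M.finiteDimensional_supported l
  have := (M.finite_spectralFreqs l).fintype
  refine (Submodule.finrank_mono (M.coeffSpace_le_supported (hy := hy) hq l)).trans_eq ?_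
  rw [(Finsupp.supportedEquivFinsupp (M := Spinor k) (R := ℂ) (M.spectralFreqs l)).finrank_eq,
    (Finsupp.linearEquivFunOnFinite ℂ (Spinor k) (M.spectralFreqs l)).finrank_eq,
    Module.finrank_pi_fintype, Module.finrank_fintype_fun_eq_card, Set.ncard_eq_toFinset_card',
    Set.toFinset_card]
  simp

end CHDManifold
end FlatCHD
end

noncomputable section

namespace FlatCHD
namespace CHDManifold

variable {k : ℕ} {V : Type*} [NormedAddCommGroup V] [InnerProductSpace ℝ V]
variable (M : CHDManifold k V)

/-! ### Splitting off the part of the spectrum which is constant along the fibres -/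

/-- The component of `ξ` orthogonal to `eₙ`. -/
def horizontal (ξ : V) : V := ξ - ⟪M.e (Fin.last (2 * k)), ξ⟫_ℝ • M.e (Fin.last (2 * k))

theorem A_e_last : M.A (M.e (Fin.last (2 * k))) = M.e (Fin.last (2 * k)) := by
  rw [M.e_last, M.A_a_last]

theorem horizontal_A (ξ : V) : M.horizontal (M.A ξ) = M.A (M.horizontal ξ) := by
  rw [horizontal, horizontal, map_sub, map_smul, A_e_last, inner_e_last_A]

theorem horizontal_A_eq_zero_iff (ξ : V) : M.horizontal (M.A ξ) = 0 ↔ M.horizontal ξ = 0 := by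
  rw [horizontal_A, map_eq_zero_iff _ M.A.injective]

theorem inner_horizontal (ξ : V) : ⟪M.e (Fin.last (2 * k)), M.horizontal ξ⟫_ℝ = 0 := by
  rw [horizontal, inner_sub_right, inner_smul_right, inner_e_self, mul_one, sub_self]

theorem cliffordMul_eq_add_horizontal (ξ : V) : M.cliffordMul ξ =
    ⟪M.e (Fin.last (2 * k)), ξ⟫_ℝ • gamma (Fin.last (2 * k)) + M.cliffordMul (M.horizontal ξ) := by
  rw [← cliffordMul_e M, ← map_smul, ← map_add, horizontal, add_sub_cancel]

theorem gamma_last_mul_cliffordMul_horizontal (ξ : V) :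
    gamma (Fin.last (2 * k)) * M.cliffordMul (M.horizontal ξ) =
      -(M.cliffordMul (M.horizontal ξ) * gamma (Fin.last (2 * k))) := by
  have h := congrArg M.cliffordRep (vec_anticomm (M.inner_horizontal ξ))
  rwa [map_neg, map_mul, map_mul, cliffordRep_vec, cliffordRep_vec, cliffordMul_e] at h

/-- The matrices anticommuting with the symbol of the Dirac operator. -/
def reflection (ξ : V) : SpinorMatrix k :=
  gamma (Fin.last (2 * k)) * M.cliffordMul (M.horizontal ξ)

/-- `ξ` is a combination of `eₙ` and its horizontal part. These two anticommute, so their product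
anticommutes with each of them. -/
theorem cliffordMul_mul_reflection (ξ : V) :
    M.cliffordMul ξ * M.reflection ξ = -(M.reflection ξ * M.cliffordMul ξ) := by
  rw [reflection, cliffordMul_eq_add_horizontal]
  have h1 := M.gamma_last_mul_cliffordMul_horizontal ξ
  have h2 : M.cliffordMul (M.horizontal ξ) * gamma (Fin.last (2 * k)) =
      -(gamma (Fin.last (2 * k)) * M.cliffordMul (M.horizontal ξ)) := by rw [h1, neg_neg]
  set β := M.cliffordMul (M.horizontal ξ)
  set G : SpinorMatrix k := gamma (Fin.last (2 * k))
  have h3 : β * (G * β) = -(G * (β * β)) := by rw [← mul_assoc, h2, neg_mul, mul_assoc]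
  have h4 : G * β * G = -(G * (G * β)) := by rw [mul_assoc, h2, mul_neg]
  simp only [add_mul, mul_add, smul_mul_assoc, mul_smul_comm, h3, h4]
  rw [mul_assoc G β β]
  module

theorem reflection_mul_self (ξ : V) :
    M.reflection ξ * M.reflection ξ = (-⟪M.horizontal ξ, M.horizontal ξ⟫_ℝ) • 1 := by
  have h1 := M.gamma_last_mul_cliffordMul_horizontal ξ
  have h2 := M.cliffordMul_sq (M.horizontal ξ)
  rw [cliffForm_apply, Algebra.algebraMap_eq_smul_one] at h2
  have h3 : M.cliffordMul (M.horizontal ξ) * gamma (Fin.last (2 * k)) =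
      -(gamma (Fin.last (2 * k)) * M.cliffordMul (M.horizontal ξ)) := by rw [h1, neg_neg]
  rw [← h2, reflection, mul_assoc, ← mul_assoc (M.cliffordMul _), h3, neg_mul, mul_neg, mul_assoc,
    ← mul_assoc (gamma _), gamma_sq, neg_one_mul, neg_neg]

/-- The general transport principle. It is used with `ε = 1` for cut-offs in frequency and with `ε =
-1` for the reflection that reverses the sign of the eigenvalue. -/
theorem twist_mem_coeffSpace {y : Spin V} {l ε : ℝ} {B : V → SpinorMatrix k}
    (h1 : ∀ ξ, M.cliffordMul ξ * B ξ = (ε : ℂ) • (B ξ * M.cliffordMul ξ))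
    (h2 : ∀ ξ, B (M.A ξ) * M.cliffordRep (y : Cl V) = M.cliffordRep (y : Cl V) * B ξ)
    {c : V →₀ Spinor k} (hc : c ∈ M.coeffSpace (M.cliffordRep (y : Cl V)) l) :
    twist B c ∈ M.coeffSpace (M.cliffordRep (y : Cl V)) (ε * l) := by
  refine ⟨fun ξ => ?_, fun i ξ => ?_, fun ξ => ?_⟩
  · rw [twist_apply, Matrix.mulVec_mulVec, smul_mul_assoc, h1, smul_comm, ← mul_smul_comm,
      Matrix.smul_mulVec, ← Matrix.mulVec_mulVec, hc.1, Matrix.mulVec_smul, smul_smul,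
      Complex.ofReal_mul]
  · rw [twist_apply, ← Matrix.mulVec_smul, hc.2.1]
  · rw [twist_apply, twist_apply, ← Matrix.mulVec_smul, hc.2.2, Matrix.mulVec_mulVec,
      Matrix.mulVec_mulVec, h2]

/-- Coefficients supported on the multiples of `eₙ`. -/
def verticalSpace (R : SpinorMatrix k) (l : ℝ) : Submodule ℂ (V →₀ Spinor k) :=
  M.coeffSpace R l ⊓ Finsupp.supported (Spinor k) ℂ {ξ | M.horizontal ξ = 0}

/-- Coefficients supported away from the multiples of `eₙ`. -/
def mixedSpace (R : SpinorMatrix k) (l : ℝ) : Submodule ℂ (V →₀ Spinor k) :=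
  M.coeffSpace R l ⊓ Finsupp.supported (Spinor k) ℂ {ξ | M.horizontal ξ ≠ 0}

theorem verticalSpace_inf_mixedSpace (R : SpinorMatrix k) (l : ℝ) :
    M.verticalSpace R l ⊓ M.mixedSpace R l = ⊥ := by
  rw [eq_bot_iff]
  rintro c ⟨⟨-, h1⟩, ⟨-, h2⟩⟩
  rw [SetLike.mem_coe, Finsupp.mem_supported'] at h1 h2
  refine Finsupp.ext fun ξ => ?_
  by_cases h : M.horizontal ξ = 0
  · exact h2 ξ (fun h' => h' h)
  · exact h1 ξ h

-- Vanishing of the horizontal part is an `A`-invariant condition, so cutting coefficients off by it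
-- respects all the defining equations.
open Classical in
theorem verticalSpace_sup_mixedSpace (y : Spin V) (l : ℝ) :
    M.verticalSpace (M.cliffordRep (y : Cl V)) l ⊔ M.mixedSpace (M.cliffordRep (y : Cl V)) l =
      M.coeffSpace (M.cliffordRep (y : Cl V)) l := by
  refine le_antisymm (sup_le inf_le_left inf_le_left) fun c hc => ?_
  have key : ∀ (p : V → Prop), (∀ ξ, p (M.A ξ) ↔ p ξ) →
      twist (fun ξ => if p ξ then (1 : SpinorMatrix k) else 0) c ∈
        M.coeffSpace (M.cliffordRep (y : Cl V)) l := by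
    intro p hp
    have h := M.twist_mem_coeffSpace (y := y) (ε := 1)
      (B := fun ξ => if p ξ then (1 : SpinorMatrix k) else 0)
      (fun ξ => by split_ifs <;> simp)
      (fun ξ => by simp only [hp]; split_ifs <;> simp) hc
    rwa [one_mul] at h
  rw [Submodule.mem_sup]
  refine ⟨_, ⟨key (fun ξ => M.horizontal ξ = 0) M.horizontal_A_eq_zero_iff, ?_⟩,
    _, ⟨key (fun ξ => M.horizontal ξ ≠ 0) fun ξ => (M.horizontal_A_eq_zero_iff ξ).not, ?_⟩, ?_⟩
  · rw [SetLike.mem_coe, Finsupp.mem_supported']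
    intro ξ hξ
    rw [twist_apply, if_neg (by simpa using hξ), Matrix.zero_mulVec]
  · rw [SetLike.mem_coe, Finsupp.mem_supported']
    intro ξ hξ
    rw [twist_apply, if_neg (by simpa using hξ), Matrix.zero_mulVec]
  · refine Finsupp.ext fun ξ => ?_
    rw [Finsupp.add_apply, twist_apply, twist_apply]
    by_cases h : M.horizontal ξ = 0 <;> simp [h]

theorem twist_reflection_mem_mixedSpace {y : Spin V} (hy : Covers y M.A) {l : ℝ}
    {c : V →₀ Spinor k} (hc : c ∈ M.mixedSpace (M.cliffordRep (y : Cl V)) l) :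
    twist M.reflection c ∈ M.mixedSpace (M.cliffordRep (y : Cl V)) (-l) := by
  refine ⟨?_, ?_⟩
  · have h := M.twist_mem_coeffSpace (y := y) (ε := -1) (B := M.reflection)
      (fun ξ => by rw [cliffordMul_mul_reflection]; simp)
      (fun ξ => by
        have h1 := M.cliffordRep_mul_cliffordMul hy (M.horizontal ξ)
        have h2 := M.cliffordRep_mul_cliffordMul hy (M.e (Fin.last (2 * k)))
        rw [A_e_last, cliffordMul_e] at h2
        rw [reflection, reflection, horizontal_A, mul_assoc, ← h1, ← mul_assoc, ← h2, mul_assoc])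
      hc.1
    rwa [neg_one_mul] at h
  · have h := hc.2
    rw [SetLike.mem_coe, Finsupp.mem_supported'] at h ⊢
    intro ξ hξ
    rw [twist_apply, h ξ hξ, Matrix.mulVec_zero]

/-- The reflection squares to minus the squared norm of the horizontal part, a nonzero scalar at
every mixed frequency, so it acts injectively. -/
theorem finrank_mixedSpace_le_neg {y : Spin V} {hy : Covers y M.A} {q : ℤ}
    (hq : M.IsLiftWithPhase y q) (l : ℝ) :
    Module.finrank ℂ (M.mixedSpace (M.cliffordRep (y : Cl V)) l) ≤
      Module.finrank ℂ (M.mixedSpace (M.cliffordRep (y : Cl V)) (-l)) := by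
  have := M.finiteDimensional_coeffSpace (hy := hy) hq (-l)
  have : FiniteDimensional ℂ (M.mixedSpace (M.cliffordRep (y : Cl V)) (-l)) :=
    Submodule.finiteDimensional_of_le inf_le_left
  refine LinearMap.finrank_le_finrank_of_injective (f := ((twist M.reflection).restrict
    fun c hc => M.twist_reflection_mem_mixedSpace hy hc)) ?_
  refine (injective_iff_map_eq_zero _).2 ?_
  rintro ⟨c, hc⟩ h
  have h0 : twist M.reflection c = 0 := congrArg Subtype.val h
  have h1 := hc.2
  rw [SetLike.mem_coe, Finsupp.mem_supported'] at h1
  refine Subtype.ext (Finsupp.ext fun ξ => ?_)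
  by_cases hξ : M.horizontal ξ = 0
  · exact h1 ξ (fun h' => h' hξ)
  · have h2 := DFunLike.congr_fun h0 ξ
    rw [twist_apply] at h2
    have h3 : M.reflection ξ *ᵥ (M.reflection ξ *ᵥ c ξ) = 0 := by
      rw [h2]; exact Matrix.mulVec_zero _
    rw [Matrix.mulVec_mulVec, reflection_mul_self, Matrix.smul_mulVec, Matrix.one_mulVec] at h3
    exact (smul_eq_zero.mp h3).resolve_left
      (neg_ne_zero.mpr fun h4 => hξ (inner_self_eq_zero.mp h4))

theorem finrank_mixedSpace_neg {y : Spin V} {hy : Covers y M.A} {q : ℤ}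
    (hq : M.IsLiftWithPhase y q) (l : ℝ) :
    Module.finrank ℂ (M.mixedSpace (M.cliffordRep (y : Cl V)) (-l)) =
      Module.finrank ℂ (M.mixedSpace (M.cliffordRep (y : Cl V)) l) := by
  refine le_antisymm ?_ (M.finrank_mixedSpace_le_neg (hy := hy) hq l)
  have h := M.finrank_mixedSpace_le_neg (hy := hy) hq (-l)
  rwa [neg_neg] at h

theorem finrank_coeffSpace_eq_add {y : Spin V} {hy : Covers y M.A} {q : ℤ}
    (hq : M.IsLiftWithPhase y q) (l : ℝ) :
    Module.finrank ℂ (M.coeffSpace (M.cliffordRep (y : Cl V)) l) =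
      Module.finrank ℂ (M.verticalSpace (M.cliffordRep (y : Cl V)) l) +
        Module.finrank ℂ (M.mixedSpace (M.cliffordRep (y : Cl V)) l) := by
  have := M.finiteDimensional_coeffSpace (hy := hy) hq l
  have : FiniteDimensional ℂ (M.verticalSpace (M.cliffordRep (y : Cl V)) l) :=
    Submodule.finiteDimensional_of_le inf_le_left
  have : FiniteDimensional ℂ (M.mixedSpace (M.cliffordRep (y : Cl V)) l) :=
    Submodule.finiteDimensional_of_le inf_le_left
  have h := Submodule.finrank_sup_add_finrank_inf_eq (M.verticalSpace (M.cliffordRep (y : Cl V)) l)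
    (M.mixedSpace (M.cliffordRep (y : Cl V)) l)
  rwa [verticalSpace_sup_mixedSpace, verticalSpace_inf_mixedSpace, finrank_bot, add_zero] at h

/-! ### The vertical part of the spectrum -/

/-- The offset of the vertical eigenvalues on the joint eigenvector indexed by `s`: these
eigenvalues are `2 π n (m + shift q s)` with `m` an integer. -/
def _root_.FlatCHD.shift (q : ℤ) (s : Fin k → Fin 2) : ℝ :=
  -totalSign s * (weight s / (2 * k + 1) + q) / 2

/-- The vertical eigenvalues on the joint eigenvector indexed by `s`. -/
def _root_.FlatCHD.verticalEigenvalue (q : ℤ) (s : Fin k → Fin 2) (m : ℤ) : ℝ :=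
  2 * Real.pi * (2 * k + 1) * (m + shift q s)

/-- The left side is the equivariance condition under `g` for the frequency `-ε l eₙ`, with `ε =
totalSign s`. Solving it for `l` modulo the period of the exponential gives an arithmetic
progression. -/
theorem _root_.FlatCHD.exp_eq_iff_mem_range_verticalEigenvalue (q : ℤ) (s : Fin k → Fin 2) (l : ℝ) :
    Complex.exp (Complex.I * ((-(totalSign s * l) / (2 * k + 1) : ℝ) : ℂ)) =
        Complex.exp (Complex.I * ((Real.pi * (weight s / (2 * k + 1) + q) : ℝ) : ℂ)) ↔
      l ∈ Set.range (verticalEigenvalue q s) := by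
  have hε : (totalSign s : ℝ) * totalSign s = 1 := by exact_mod_cast totalSign_mul_self s
  have hn : (2 * (k : ℝ) + 1) ≠ 0 := by positivity
  rw [Complex.exp_eq_exp_iff_exists_int]
  have h1 : ∀ m : ℤ, Complex.I * ((-(totalSign s * l) / (2 * k + 1) : ℝ) : ℂ) =
      Complex.I * ((Real.pi * (weight s / (2 * k + 1) + q) : ℝ) : ℂ) +
        m * (2 * Real.pi * Complex.I) ↔
      -(totalSign s * l) / (2 * k + 1) =
        Real.pi * (weight s / (2 * k + 1) + q) + m * (2 * Real.pi) := by
    intro m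
    rw [show Complex.I * ((Real.pi * (weight s / (2 * k + 1) + q) : ℝ) : ℂ) +
        m * (2 * Real.pi * Complex.I) = Complex.I *
        ((Real.pi * (weight s / (2 * k + 1) + q) + m * (2 * Real.pi) : ℝ) : ℂ) by push_cast; ring,
      mul_right_inj' Complex.I_ne_zero, Complex.ofReal_inj]
  simp only [h1]
  constructor
  · rintro ⟨m, hm⟩
    -- Solving for `l` multiplies the equation by `-ε`, hence also the integer; `ε ^ 2 = 1` makes
    -- this reversible.
    refine ⟨-totalSign s * m, ?_⟩
    rw [div_eq_iff hn] at hm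
    rw [verticalEigenvalue, shift]
    push_cast
    linear_combination (totalSign s : ℝ) * hm + l * hε
  · rintro ⟨m, rfl⟩
    refine ⟨-totalSign s * m, ?_⟩
    rw [verticalEigenvalue, shift, div_eq_iff hn]
    push_cast
    linear_combination (Real.pi * (2 * k + 1) * (weight s / (2 * k + 1) + q)) * hε

/-- The joint eigenbasis. -/
def _root_.FlatCHD.eigenvector (s : Fin k → Fin 2) : Spinor k := eigenMatrix k *ᵥ Pi.single s 1

theorem _root_.FlatCHD.linearIndependent_eigenvector :
    LinearIndependent ℂ (eigenvector : (Fin k → Fin 2) → Spinor k) := by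
  have h : (eigenvector : (Fin k → Fin 2) → Spinor k) = (eigenMatrix k).col :=
    funext fun s => Matrix.mulVec_single_one _ _
  rw [h, Matrix.linearIndependent_cols_iff_isUnit]
  exact ⟨⟨_, _, eigenMatrix_mul_inv k, eigenMatrix_inv_mul k⟩, rfl⟩

theorem _root_.FlatCHD.eq_sum_eigenvector (u : Spinor k) :
    u = ∑ s, (eigenMatrixInv k *ᵥ u) s • eigenvector s := by
  have h : u = eigenMatrix k *ᵥ (eigenMatrixInv k *ᵥ u) := by
    rw [Matrix.mulVec_mulVec, eigenMatrix_mul_inv, Matrix.one_mulVec]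
  have h2 : (eigenMatrixInv k *ᵥ u) = ∑ s, (eigenMatrixInv k *ᵥ u) s • (Pi.single s 1 : Spinor k) := by
    funext t; simp [Finset.sum_apply, Pi.single_apply]
  conv_lhs => rw [h, h2]
  rw [Matrix.mulVec_sum]
  simp only [Matrix.mulVec_smul, eigenvector]

theorem _root_.FlatCHD.mulVec_eigenvector {B : SpinorMatrix k} {d : (Fin k → Fin 2) → ℂ}
    (h : B * eigenMatrix k = eigenMatrix k * Matrix.diagonal d) (s : Fin k → Fin 2) :
    B *ᵥ eigenvector s = d s • eigenvector s := by
  rw [eigenvector, Matrix.mulVec_mulVec, h, ← Matrix.mulVec_mulVec, Matrix.diagonal_mulVec_single,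
    ← Matrix.mulVec_smul]
  congr 1
  ext t
  simp [Pi.single_apply]

theorem _root_.FlatCHD.eigenMatrixInv_mulVec {B : SpinorMatrix k} {d : (Fin k → Fin 2) → ℂ}
    (h : B * eigenMatrix k = eigenMatrix k * Matrix.diagonal d) (u : Spinor k) (s : Fin k → Fin 2) :
    (eigenMatrixInv k *ᵥ (B *ᵥ u)) s = d s * (eigenMatrixInv k *ᵥ u) s := by
  have h1 : eigenMatrixInv k * B = Matrix.diagonal d * eigenMatrixInv k := by
    calc eigenMatrixInv k * B = eigenMatrixInv k * (B * eigenMatrix k) * eigenMatrixInv k := by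
          rw [mul_assoc, mul_assoc B, eigenMatrix_mul_inv, mul_one]
      _ = _ := by rw [h, ← mul_assoc, eigenMatrix_inv_mul, one_mul]
  rw [Matrix.mulVec_mulVec, h1, ← Matrix.mulVec_mulVec, Matrix.mulVec_diagonal]

open Classical in
/-- The number of joint eigenvectors contributing the eigenvalue `l`. -/
def _root_.FlatCHD.verticalMultiplicity (k : ℕ) (q : ℤ) (l : ℝ) : ℕ :=
  (Finset.univ.filter fun s : Fin k → Fin 2 => l ∈ Set.range (verticalEigenvalue q s)).card

/-- The coefficients of the eigenspinor with eigenvalue `l` attached to `s`. -/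
def verticalMode (l : ℝ) (s : Fin k → Fin 2) : V →₀ Spinor k :=
  Finsupp.single (-(totalSign s * l) • M.e (Fin.last (2 * k))) (eigenvector s)

theorem charFun_smul_e_last (t : ℝ) : charFun (t • M.e (Fin.last (2 * k)))
    ((1 / (2 * k + 1) : ℝ) • M.a (Fin.last (2 * k))) =
      Complex.exp (Complex.I * ((t / (2 * k + 1) : ℝ) : ℂ)) := by
  rw [charFun, ← M.e_last, inner_smul_left, inner_smul_right, inner_e_self]
  congr 3
  simp [div_eq_mul_inv]

theorem horizontal_smul_e_last (t : ℝ) : M.horizontal (t • M.e (Fin.last (2 * k))) = 0 := by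
  rw [horizontal, inner_smul_right, inner_e_self, mul_one, sub_self]

theorem eq_smul_e_last {ξ : V} (h : M.horizontal ξ = 0) :
    ξ = ⟪M.e (Fin.last (2 * k)), ξ⟫_ℝ • M.e (Fin.last (2 * k)) := sub_eq_zero.mp h

/-- The frequency is dictated by the Dirac equation: `eₙ` acts on the eigenvector by `i ε`, so `i t
eₙ` has eigenvalue `-ε t`, which equals `l` for `t = -ε l`. -/
theorem verticalMode_mem {y : Spin V} {q : ℤ} (hq : M.IsLiftWithPhase y q) {l : ℝ}
    {s : Fin k → Fin 2} (hs : l ∈ Set.range (verticalEigenvalue q s)) :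
    M.verticalMode l s ∈ M.verticalSpace (M.cliffordRep (y : Cl V)) l := by
  classical
  have hε : (totalSign s : ℂ) * totalSign s = 1 := by exact_mod_cast totalSign_mul_self s
  rw [← exp_eq_iff_mem_range_verticalEigenvalue] at hs
  set ξ₀ := -(totalSign s * l) • M.e (Fin.last (2 * k)) with hξ₀
  have hA : M.A ξ₀ = ξ₀ := by rw [hξ₀, map_smul, A_e_last]
  refine ⟨⟨fun ξ => ?_, fun i ξ => ?_, fun ξ => ?_⟩, ?_⟩
  · rw [verticalMode, Finsupp.single_apply]
    split_ifs with h
    · rw [← h, ← hξ₀, hξ₀, map_smul, cliffordMul_e, Matrix.smul_mulVec, Matrix.smul_mulVec,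
        mulVec_eigenvector (gamma_last_mul_eigenMatrix k), ← Complex.coe_smul, smul_smul, smul_smul]
      congr 1
      push_cast
      linear_combination (-(totalSign s : ℂ) * totalSign s * l) * Complex.I_mul_I + (l : ℂ) * hε
    · simp
  · rw [verticalMode, Finsupp.single_apply]
    split_ifs with h
    · rw [← h, charFun, ← hξ₀, hξ₀, inner_smul_left]
      have h0 : ⟪M.e (Fin.last (2 * k)), M.a i.castSucc⟫_ℝ = 0 := M.inner_e_last_a i.val i.isLt
      rw [h0]
      simp
    · simp
  · rw [verticalMode, Finsupp.single_apply, Finsupp.single_apply]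
    by_cases h : ξ₀ = ξ
    · rw [← hξ₀, if_pos h, ← h, hA, if_pos rfl, mulVec_eigenvector hq, hξ₀, charFun_smul_e_last, hs]
    · have h2 : ξ₀ ≠ M.A ξ := fun h3 => h (M.A.injective (hA.trans h3))
      rw [← hξ₀, if_neg h, if_neg h2]
      simp
  · rw [SetLike.mem_coe, Finsupp.mem_supported']
    intro ξ hξ
    rw [verticalMode, Finsupp.single_apply, if_neg]
    rintro rfl
    exact hξ (M.horizontal_smul_e_last _)

/-- In the joint eigenbasis the equations decouple. A nonzero coordinate at `s` forces both the
frequency and membership of `l` in the progression of `s`. -/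
theorem single_mem_span_verticalMode {y : Spin V} {q : ℤ} (hq : M.IsLiftWithPhase y q) {l : ℝ}
    {c : V →₀ Spinor k} (hc : c ∈ M.coeffSpace (M.cliffordRep (y : Cl V)) l) {ξ : V}
    (hξ : M.horizontal ξ = 0) : Finsupp.single ξ (c ξ) ∈ Submodule.span ℂ (Set.range
      fun s : {s : Fin k → Fin 2 // l ∈ Set.range (verticalEigenvalue q s)} =>
        M.verticalMode l s.1) := by
  have hξt := M.eq_smul_e_last hξ
  set t := ⟪M.e (Fin.last (2 * k)), ξ⟫_ℝ with ht
  have hA : M.A ξ = ξ := by rw [hξt, map_smul, A_e_last]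
  rw [eq_sum_eigenvector (c ξ), ← Finsupp.lsingle_apply (R := ℂ), map_sum]
  refine Submodule.sum_mem _ fun s _ => ?_
  have hε : (totalSign s : ℂ) * totalSign s = 1 := by exact_mod_cast totalSign_mul_self s
  rw [map_smul, Finsupp.lsingle_apply]
  set w := (eigenMatrixInv k *ᵥ c ξ) s with hw
  by_cases hw0 : w = 0
  · rw [hw0, zero_smul]; exact Submodule.zero_mem _
  refine Submodule.smul_mem _ _ ?_
  have h1 : -((totalSign s : ℂ) * l) = t := by
    have h := congrArg (fun u => (eigenMatrixInv k *ᵥ u) s) (hc.1 ξ)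
    simp only [Matrix.mulVec_smul, Pi.smul_apply, ← hw, smul_eq_mul] at h
    rw [hξt, map_smul, cliffordMul_e, Matrix.smul_mulVec, Matrix.smul_mulVec, Matrix.mulVec_smul,
      ← Complex.coe_smul, Matrix.mulVec_smul, Pi.smul_apply, Pi.smul_apply,
      ← hξt, eigenMatrixInv_mulVec (gamma_last_mul_eigenMatrix k), ← hw, smul_eq_mul,
      smul_eq_mul] at h
    have h' : (-((t : ℂ) * totalSign s)) * w = l * w := by
      rw [← h]; linear_combination (-(t : ℂ) * totalSign s * w) * Complex.I_mul_I
    have h2 := mul_right_cancel₀ hw0 h'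
    rw [← h2]
    linear_combination (t : ℂ) * hε
  have h1' : -((totalSign s : ℝ) * l) = t := by exact_mod_cast h1
  have h2 : l ∈ Set.range (verticalEigenvalue q s) := by
    rw [← exp_eq_iff_mem_range_verticalEigenvalue, h1']
    have h := congrArg (fun u => (eigenMatrixInv k *ᵥ u) s) (hc.2.2 ξ)
    simp only [hA, Matrix.mulVec_smul, Pi.smul_apply, ← hw, smul_eq_mul] at h
    rw [eigenMatrixInv_mulVec hq, ← hw, hξt, charFun_smul_e_last] at h
    exact mul_right_cancel₀ hw0 h
  refine Submodule.subset_span ⟨⟨s, h2⟩, ?_⟩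
  change Finsupp.single (-(totalSign s * l) • M.e (Fin.last (2 * k))) (eigenvector s) = _
  rw [h1', ← hξt]

theorem verticalSpace_eq_span {y : Spin V} {q : ℤ} (hq : M.IsLiftWithPhase y q) (l : ℝ) :
    M.verticalSpace (M.cliffordRep (y : Cl V)) l = Submodule.span ℂ (Set.range
      fun s : {s : Fin k → Fin 2 // l ∈ Set.range (verticalEigenvalue q s)} =>
        M.verticalMode l s.1) := by
  refine le_antisymm (fun c hc => ?_) (Submodule.span_le.2 ?_)
  · have hsupp := (Finsupp.mem_supported' ℂ c).1 hc.2
    rw [← Finsupp.sum_single c]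
    refine Submodule.sum_mem _ fun ξ hξ => ?_
    refine M.single_mem_span_verticalMode hq hc.1 ?_
    by_contra h
    exact (Finsupp.mem_support_iff.mp hξ) (hsupp ξ h)
  · rintro _ ⟨s, rfl⟩
    exact M.verticalMode_mem hq s.2

theorem finrank_verticalSpace {y : Spin V} {q : ℤ} (hq : M.IsLiftWithPhase y q) (l : ℝ) :
    Module.finrank ℂ (M.verticalSpace (M.cliffordRep (y : Cl V)) l) =
      verticalMultiplicity k q l := by
  classical
  have hli : LinearIndependent ℂ
      fun s : {s : Fin k → Fin 2 // l ∈ Set.range (verticalEigenvalue q s)} =>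
        M.verticalMode l s.1 := by
    -- Modes may share a frequency. Adding up all coefficients sends them to distinct members of the
    -- joint eigenbasis, so they are independent regardless.
    refine LinearIndependent.of_comp (Finsupp.lsum ℂ fun _ : V => LinearMap.id) ?_
    have h := (linearIndependent_eigenvector (k := k)).comp
      (Subtype.val : {s : Fin k → Fin 2 // l ∈ Set.range (verticalEigenvalue q s)} → _)
      Subtype.val_injective
    convert h using 1
    funext s
    simp [verticalMode]
  rw [verticalSpace_eq_span M hq, finrank_span_eq_card hli, verticalMultiplicity,
    Fintype.card_subtype]

end CHDManifold
end FlatCHD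
end

noncomputable section

namespace FlatCHD

open HurwitzZeta

/-! ### The contribution of the vertical spectrum to the eta function -/

/-- The eta function. -/
def etaFun (k : ℕ) (q : ℤ) (z : ℂ) : ℂ :=
  ∑ s : Fin k → Fin 2, 2 * ((2 * Real.pi * (2 * k + 1) : ℝ) : ℂ) ^ (-z) *
    hurwitzZetaOdd (shift q s) z

theorem differentiable_etaFun (k : ℕ) (q : ℤ) : Differentiable ℂ (etaFun k q) := by
  refine Differentiable.fun_sum fun s _ => ?_
  refine Differentiable.mul ?_ (differentiable_hurwitzZetaOdd _)
  refine (differentiable_neg.const_cpow (Or.inl ?_)).const_mul 2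
  have : (0 : ℝ) < 2 * Real.pi * (2 * k + 1) := by positivity
  exact_mod_cast this.ne'

theorem etaFun_zero (k : ℕ) (q : ℤ) : etaFun k q 0 =
    ∑ s : Fin k → Fin 2, 2 * hurwitzZetaOdd (shift q s) 0 := by
  simp [etaFun]

theorem ofReal_sign_eq (t : ℝ) : ((Real.sign t : ℝ) : ℂ) = (SignType.sign t : ℂ) := by
  rcases lt_trichotomy t 0 with h | rfl | h
  · rw [Real.sign_of_neg h, sign_neg h]; simp
  · simp
  · rw [Real.sign_of_pos h, sign_pos h]; simp

theorem verticalEigenvalue_injective {k : ℕ} (q : ℤ) (s : Fin k → Fin 2) :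
    Function.Injective (verticalEigenvalue q s) := by
  intro m m' h
  have : (2 * Real.pi * (2 * k + 1) : ℝ) ≠ 0 := by positivity
  have h2 := mul_left_cancel₀ this h
  exact_mod_cast add_right_cancel h2

-- The series is supported on an injective image of `ℤ`, where it is the bilateral series for
-- `hurwitzZetaOdd`; the factor `2` undoes the `1/2` in Mathlib's normalization.
open Classical in
theorem hasSum_verticalEigenvalue {k : ℕ} (q : ℤ) (s : Fin k → Fin 2) {z : ℂ} (hz : 1 < z.re) :
    HasSum (fun l : ℝ => if l ∈ Set.range (verticalEigenvalue q s) then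
      ((Real.sign l : ℝ) : ℂ) * ((|l| : ℝ) : ℂ) ^ (-z) else 0)
      (2 * ((2 * Real.pi * (2 * k + 1) : ℝ) : ℂ) ^ (-z) * hurwitzZetaOdd (shift q s) z) := by
  rw [← (verticalEigenvalue_injective q s).hasSum_iff (fun l hl => if_neg hl)]
  have hC : (0 : ℝ) < 2 * Real.pi * (2 * k + 1) := by positivity
  refine ((hasSum_int_hurwitzZetaOdd (shift q s) hz).mul_left _).congr_fun fun m => ?_
  rw [Function.comp, if_pos ⟨m, rfl⟩, verticalEigenvalue, ofReal_sign_eq, sign_mul, sign_pos hC,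
    one_mul, abs_mul, abs_of_pos hC, Complex.ofReal_mul _ |_|,
    Complex.mul_cpow_ofReal_nonneg hC.le (abs_nonneg _), Complex.cpow_neg ((|_| : ℝ) : ℂ)]
  ring

theorem hasSum_verticalMultiplicity (k : ℕ) (q : ℤ) {z : ℂ} (hz : 1 < z.re) :
    HasSum (fun l : ℝ => (verticalMultiplicity k q l : ℂ) * ((Real.sign l : ℝ) : ℂ) *
      ((|l| : ℝ) : ℂ) ^ (-z)) (etaFun k q z) := by
  classical
  refine (hasSum_sum fun s (_ : s ∈ Finset.univ) => hasSum_verticalEigenvalue q s hz).congr_fun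
    fun l => ?_
  rw [← Finset.sum_filter, Finset.sum_const, nsmul_eq_mul, verticalMultiplicity, mul_assoc]

/-! ### Convergence of the eta series -/

theorem summable_sphere_card {ι V : Type*} [Fintype ι] [DecidableEq ι] [NormedAddCommGroup V]
    [InnerProductSpace ℝ V] (b : Module.Basis ι ℝ V) {r : ℝ}
    (h : Summable fun ξ : freqLattice b => ‖(ξ : V)‖ ^ (-r)) :
    Summable fun l : ℝ => ({ξ : V | ξ ∈ freqLattice b ∧ ‖ξ‖ = |l|}.ncard : ℝ) * |l| ^ (-r) := by
  set N : freqLattice b → ℝ := fun ξ => ‖(ξ : V)‖ with hN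
  have h1 : Summable fun p : (Σ y : ℝ, {ξ : freqLattice b // N ξ = y}) => N p.2.1 ^ (-r) :=
    (Equiv.sigmaFiberEquiv N).summable_iff.2 h
  have h2 : Summable fun y : ℝ => ∑' ξ : {ξ : freqLattice b // N ξ = y}, N ξ.1 ^ (-r) := h1.sigma
  -- Each sphere is counted for both `l` and `-l`, so the sum over norms is added to its reflection
  -- to obtain a majorant on all of `ℝ`.
  have h3 := h2.add ((Equiv.neg ℝ).summable_iff.2 h2)
  have hnn : ∀ y : ℝ, 0 ≤ ∑' ξ : {ξ : freqLattice b // N ξ = y}, N ξ.1 ^ (-r) := fun y =>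
    tsum_nonneg fun ξ => Real.rpow_nonneg (norm_nonneg _) _
  refine Summable.of_nonneg_of_le (fun l => by positivity) (fun l => ?_) h3
  have h4 : ({ξ : V | ξ ∈ freqLattice b ∧ ‖ξ‖ = |l|}.ncard : ℝ) * |l| ^ (-r) =
      ∑' ξ : {ξ : freqLattice b // N ξ = |l|}, N ξ.1 ^ (-r) := by
    have h5 : ∀ ξ : {ξ : freqLattice b // N ξ = |l|}, N ξ.1 ^ (-r) = |l| ^ (-r) := fun ξ => by
      rw [ξ.2]
    rw [tsum_congr h5, tsum_const, nsmul_eq_mul]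
    congr 2
    rw [← Nat.card_coe_set_eq]
    exact Nat.card_congr ⟨fun ξ => ⟨⟨ξ.1, ξ.2.1⟩, ξ.2.2⟩, fun ξ => ⟨ξ.1.1, ξ.1.2, ξ.2⟩,
      fun _ => rfl, fun _ => rfl⟩
  rw [h4]
  rcases abs_choice l with hl | hl
  · rw [hl]; exact le_add_of_nonneg_right (hnn _)
  · rw [hl]; exact le_add_of_nonneg_left (hnn _)

theorem norm_signed_term_le (a : ℕ) (l : ℝ) (z : ℂ) :
    ‖(a : ℂ) * ((Real.sign l : ℝ) : ℂ) * ((|l| : ℝ) : ℂ) ^ (-z)‖ ≤ a * |l| ^ (-z.re) := by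
  rcases eq_or_ne l 0 with rfl | hl
  · simp only [Real.sign_zero, Complex.ofReal_zero, mul_zero, zero_mul, norm_zero]
    positivity
  · rw [norm_mul, norm_mul, Complex.norm_cpow_eq_rpow_re_of_pos (abs_pos.2 hl), Complex.norm_natCast,
      Complex.neg_re]
    have h : ‖((Real.sign l : ℝ) : ℂ)‖ ≤ 1 := by
      rcases Real.sign_apply_eq l with h | h | h <;> rw [h] <;> simp
    have h2 : 0 ≤ |l| ^ (-z.re) := by positivity
    nlinarith [mul_le_mul_of_nonneg_left h (a.cast_nonneg (α := ℝ))]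

theorem hasSum_zero_of_odd {f : ℝ → ℂ} (hf : Summable f) (h : ∀ l, f (-l) = -f l) :
    HasSum f 0 := by
  have h1 := hf.hasSum
  have h2 := (Equiv.neg ℝ).hasSum_iff.2 h1
  have h3 : HasSum f (-∑' l, f l) := by
    refine h2.neg.congr_fun fun l => ?_
    simp [h]
  rwa [self_eq_neg.mp (h1.unique h3)] at h1

/-! ### Existence and uniqueness of the eta invariant -/

namespace CHDManifold

variable {k : ℕ} {V : Type*} [NormedAddCommGroup V] [InnerProductSpace ℝ V]
variable (M : CHDManifold k V)

/-- The mixed multiplicities are even in `l`, so their signed series is odd and sums to zero once it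
is known to converge; the vertical part gives `etaFun`. -/
theorem exists_hasSum_etaFun {y : Spin V} {hy : Covers y M.A} {q : ℤ}
    (hq : M.IsLiftWithPhase y q) : ∃ R : ℝ, ∀ z : ℂ, R < z.re →
      HasSum (fun l : ℝ =>
        (Module.finrank ℂ (M.eigenspace (M.spinStructureOfLift y hy) l) : ℂ) *
          ((Real.sign l : ℝ) : ℂ) * ((|l| : ℝ) : ℂ) ^ (-z)) (etaFun k q z) := by
  obtain ⟨R, hR⟩ := exists_summable_freqLattice M.periodBasis
  refine ⟨max R 1, fun z hz => ?_⟩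
  have hsum := (summable_sphere_card M.periodBasis (hR z.re (lt_of_le_of_lt (le_max_left _ _) hz))
    ).mul_left (2 ^ k : ℝ)
  have h0 := hasSum_verticalMultiplicity k q (lt_of_le_of_lt (le_max_right _ _) hz)
  set mx : ℝ → ℕ := fun l => Module.finrank ℂ (M.mixedSpace (M.cliffordRep (y : Cl V)) l) with hmx
  have h1 : HasSum (fun l : ℝ => (mx l : ℂ) * ((Real.sign l : ℝ) : ℂ) *
      ((|l| : ℝ) : ℂ) ^ (-z)) 0 := by
    refine hasSum_zero_of_odd (Summable.of_norm_bounded hsum fun l => ?_) fun l => ?_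
    · refine (norm_signed_term_le _ l z).trans ?_
      rw [← mul_assoc, mul_comm (2 ^ k : ℝ)]
      refine mul_le_mul_of_nonneg_right ?_ (by positivity)
      have h2 : mx l ≤ (M.spectralFreqs l).ncard * 2 ^ k := by
        refine le_trans ?_ (M.finrank_coeffSpace_le (hy := hy) hq l)
        rw [M.finrank_coeffSpace_eq_add (hy := hy) hq l]
        exact Nat.le_add_left _ _
      exact_mod_cast h2
    · have h3 : mx (-l) = mx l := M.finrank_mixedSpace_neg (hy := hy) hq l
      rw [h3, Real.sign_neg, abs_neg, Complex.ofReal_neg]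
      ring
  have h2 := h0.add h1
  rw [add_zero] at h2
  refine h2.congr_fun fun l => ?_
  rw [M.finrank_eigenspace hq, M.finrank_coeffSpace_eq_add (hy := hy) hq, M.finrank_verticalSpace hq]
  push_cast
  ring

theorem isEtaInvariant_etaFun {y : Spin V} {hy : Covers y M.A} {q : ℤ}
    (hq : M.IsLiftWithPhase y q) :
    M.IsEtaInvariant (M.spinStructureOfLift y hy) (etaFun k q 0) := by
  refine ⟨fun l => ?_, etaFun k q, fun z => ?_, ?_, rfl, M.exists_hasSum_etaFun hq⟩
  · have := M.finiteDimensional_coeffSpace (hy := hy) hq l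
    exact Module.Finite.equiv (M.coeffSpaceEquiv (hy := hy) hq l)
  · exact ((differentiable_etaFun k q).analyticAt z).meromorphicAt
  · exact (differentiable_etaFun k q).analyticAt 0

/-- Two continuations agree on a half-plane, so their difference has infinite order at a point
there, hence everywhere on the connected plane. Regularity at `0` then upgrades agreement near `0`
to agreement at `0`. -/
theorem IsEtaInvariant.unique {M : CHDManifold k V} {σ : M.SpinStructure} {c d : ℂ}
    (hc : M.IsEtaInvariant σ c) (hd : M.IsEtaInvariant σ d) : c = d := by
  obtain ⟨-, f, hf, hf0, rfl, R, hR⟩ := hc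
  obtain ⟨-, g, hg, hg0, rfl, R', hR'⟩ := hd
  have hm : MeromorphicOn (f - g) Set.univ := fun z _ => (hf z).sub (hg z)
  set z₀ : ℂ := ((max R R' + 1 : ℝ) : ℂ) with hz₀
  have htop : meromorphicOrderAt (f - g) z₀ = ⊤ := by
    rw [meromorphicOrderAt_eq_top_iff]
    refine Filter.Eventually.filter_mono nhdsWithin_le_nhds ?_
    filter_upwards [(isOpen_lt continuous_const Complex.continuous_re).mem_nhds
      (show max R R' < z₀.re by rw [hz₀, Complex.ofReal_re]; linarith)] with z hz
    have h1 := hR z ((le_max_left _ _).trans_lt hz)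
    have h2 := hR' z ((le_max_right _ _).trans_lt hz)
    rw [Pi.sub_apply, h1.unique h2, sub_self]
  have h0 : meromorphicOrderAt (f - g) 0 = ⊤ := by
    by_contra h
    exact hm.meromorphicOrderAt_ne_top_of_isPreconnected isPreconnected_univ (Set.mem_univ 0)
      (Set.mem_univ z₀) h htop
  rw [meromorphicOrderAt_eq_top_iff] at h0
  have hcont : Filter.Tendsto (f - g) (nhdsWithin 0 {0}ᶜ) (nhds ((f - g) 0)) :=
    ((hf0.continuousAt.sub hg0.continuousAt).tendsto).mono_left nhdsWithin_le_nhds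
  have h1 : Filter.Tendsto (f - g) (nhdsWithin 0 {0}ᶜ) (nhds 0) :=
    tendsto_const_nhds.congr' (h0.mono fun z hz => hz.symm)
  exact sub_eq_zero.mp (tendsto_nhds_unique hcont h1)

end CHDManifold

/-! ### Parity of the difference of the eta invariants -/

/-- The contribution of a point of the circle to the difference of the eta invariants. -/
def etaJump (a : UnitAddCircle) : ℂ :=
  2 * hurwitzZetaOdd a 0 - 2 * hurwitzZetaOdd (a + ((1 / 2 : ℝ) : UnitAddCircle)) 0

theorem coe_int_circle (z : ℤ) : ((z : ℝ) : UnitAddCircle) = 0 :=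
  (AddCircle.coe_eq_zero_iff (1 : ℝ)).2 ⟨z, by simp⟩

theorem etaJump_neg (a : UnitAddCircle) : etaJump (-a) = -etaJump a := by
  have h : -a + ((1 / 2 : ℝ) : UnitAddCircle) = -(a + ((1 / 2 : ℝ) : UnitAddCircle)) := by
    have h1 : ((1 / 2 : ℝ) : UnitAddCircle) + ((1 / 2 : ℝ) : UnitAddCircle) = 0 := by
      rw [← AddCircle.coe_add, show (1 / 2 + 1 / 2 : ℝ) = ((1 : ℤ) : ℝ) by norm_num, coe_int_circle]
    rw [neg_add, add_right_inj]
    exact eq_neg_of_add_eq_zero_left h1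
  rw [etaJump, etaJump, h, hurwitzZetaOdd_neg, hurwitzZetaOdd_neg]
  ring

theorem exists_int_etaJump (a : UnitAddCircle) : ∃ d : ℤ, etaJump a = d := by
  obtain ⟨x, rfl⟩ := QuotientAddGroup.mk_surjective a
  obtain ⟨d, hd⟩ := exists_int_hurwitzZetaOdd_sub x
  refine ⟨d, ?_⟩
  rw [← hd, AddCircle.coe_add]
  rfl

/-- The offset really changes by `-ε / 2` with `ε = ±1`; both signs agree modulo `1`. -/
theorem shift_add_one {k : ℕ} (q : ℤ) (s : Fin k → Fin 2) :
    (shift (q + 1) s : UnitAddCircle) = shift q s + ((1 / 2 : ℝ) : UnitAddCircle) := by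
  have h : totalSign s = 1 ∨ totalSign s = -1 :=
    mul_self_eq_one_iff.1 (totalSign_mul_self s)
  rw [← AddCircle.coe_add]
  rcases h with h | h
  · have : shift (q + 1) s = shift q s + 1 / 2 + ((-1 : ℤ) : ℝ) := by
      rw [shift, shift, h]; push_cast; ring
    rw [this, AddCircle.coe_add, coe_int_circle, add_zero]
  · congr 1
    rw [shift, shift, h]; push_cast; ring

theorem etaFun_sub_etaFun (k : ℕ) (q : ℤ) : etaFun k q 0 - etaFun k (q + 1) 0 =
    ∑ s : Fin k → Fin 2, etaJump (shift q s) := by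
  rw [etaFun_zero, etaFun_zero, ← Finset.sum_sub_distrib]
  simp only [shift_add_one, etaJump]

/-- Reversal of all signs. -/
def flipSigns {k : ℕ} (s : Fin k → Fin 2) : Fin k → Fin 2 := fun m => (s m).rev

theorem bitSign_rev (a : Fin 2) : bitSign a.rev = -bitSign a := by
  fin_cases a <;> simp [bitSign, Fin.rev]

/-- Flipping negates the weight and multiplies the total sign by `(-1) ^ k`. The term containing `q`
then matches only up to the integer `totalSign s * q`, which disappears on the circle. -/
theorem shift_flipSigns {k : ℕ} (q : ℤ) (s : Fin k → Fin 2) :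
    (shift q (flipSigns s) : UnitAddCircle) =
      if Even k then -(shift q s : UnitAddCircle) else (shift q s : UnitAddCircle) := by
  have hw : weight (flipSigns s) = -weight s := by
    simp only [weight, flipSigns, bitSign_rev, neg_mul, Finset.sum_neg_distrib]
  have ht : totalSign (flipSigns s) = (-1) ^ k * totalSign s := by
    rw [totalSign, totalSign]
    simp only [flipSigns, bitSign_rev]
    rw [Finset.prod_neg, Finset.card_univ, Fintype.card_fin]
  split_ifs with hk
  · rw [hk.neg_one_pow, one_mul] at ht
    have : shift q (flipSigns s) = -shift q s + ((-(totalSign s * q) : ℤ) : ℝ) := by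
      rw [shift, shift, hw, ht]; push_cast; ring
    rw [this, AddCircle.coe_add, coe_int_circle, add_zero, AddCircle.coe_neg]
  · rw [(Nat.not_even_iff_odd.mp hk).neg_one_pow] at ht
    have : shift q (flipSigns s) = shift q s + ((totalSign s * q : ℤ) : ℝ) := by
      rw [shift, shift, hw, ht]; push_cast; ring
    rw [this, AddCircle.coe_add, coe_int_circle, add_zero]

/-- Modulo `2` the jumps at `s` and at its flip cancel, whichever sign relates them. The argument
works for every `q`, so the sign normalization of `α₊` does not affect the parity. -/
theorem exists_etaFun_sub_eq_two_mul (k : ℕ) (q : ℤ) :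
    ∃ m : ℤ, etaFun k q 0 - etaFun k (q + 1) 0 = ((2 * m : ℤ) : ℂ) := by
  choose d hd using exists_int_etaJump
  have hdneg : ∀ a, d (-a) = -d a := fun a => by
    have h := etaJump_neg a
    rw [hd, hd] at h
    exact_mod_cast h
  have hsum : ∑ s : Fin k → Fin 2, ((d (shift q s) : ℤ) : ZMod 2) = 0 := by
    refine Finset.sum_involution (fun s _ => flipSigns s) (fun s _ => ?_) (fun s _ hs hfix => ?_)
      (fun s _ => Finset.mem_univ _) (fun s _ => ?_)
    · rw [shift_flipSigns]
      split_ifs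
      · rw [hdneg]; push_cast; ring
      · exact CharTwo.add_self_eq_zero _
    -- The flip has a fixed point only for `k = 0`. There the offset equals its own negative on the
    -- circle, so the jump vanishes.
    · rcases Nat.eq_zero_or_pos k with rfl | hk
      · have h := shift_flipSigns q s
        rw [hfix, if_pos (by simp)] at h
        have h2 := congrArg d h
        rw [hdneg] at h2
        exact hs (by rw [self_eq_neg.mp h2]; simp)
      · have h := congrFun hfix ⟨0, hk⟩
        rw [flipSigns] at h
        have h2 := bitSign_rev (s ⟨0, hk⟩)
        rw [h] at h2
        have h3 := bitSign_mul_self (s ⟨0, hk⟩)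
        rw [self_eq_neg.mp h2] at h3
        simp at h3
    · funext m; simp [flipSigns]
  rw [← Int.cast_sum, ZMod.intCast_zmod_eq_zero_iff_dvd] at hsum
  obtain ⟨m, hm⟩ := hsum
  refine ⟨m, ?_⟩
  rw [etaFun_sub_etaFun]
  simp only [hd]
  rw [← Int.cast_sum, hm]
  rfl

end FlatCHD
end

/-! ### Comparison of the two spin structures -/

theorem corollary2 (k : ℕ) {V : Type*} [NormedAddCommGroup V] [InnerProductSpace ℝ V]
    (M : FlatCHD.CHDManifold k V) :
    (∃ c : ℂ, M.IsEtaInvariant M.spinPlus c) ∧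
    (∃ c : ℂ, M.IsEtaInvariant M.spinMinus c) ∧
    ∀ cp cm : ℂ, M.IsEtaInvariant M.spinPlus cp → M.IsEtaInvariant M.spinMinus cm →
      ∃ m : ℤ, cp - cm = ((2 * m : ℤ) : ℂ) := by
  have hp : M.IsEtaInvariant M.spinPlus _ := M.isEtaInvariant_etaFun M.isLiftWithPhase_alphaPlus
  have hm : M.IsEtaInvariant M.spinMinus _ := M.isEtaInvariant_etaFun M.isLiftWithPhase_alphaMinus
  refine ⟨⟨_, hp⟩, ⟨_, hm⟩, fun cp cm hcp hcm => ?_⟩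
  rw [hcp.unique hp, hcm.unique hm]
  exact FlatCHD.exists_etaFun_sub_eq_two_mul k _
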